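/- Let $R$ be a commutative ring with unit, let $n\ge 1$, and let $X=\{x_1<\dots<x_n\}$ be a totally ordered alphabet. Consider the free $R$-algebra on $X$ with two compatible Lie brackets, i.e. the algebra generated by $X$ with two bilinear operations $[\cdot,\cdot]$ and $\langle\cdot,\cdot\rangle$, subject only to the identities, for all elements $x,y,z$, $$[x,y]+[y,x]=0,\qquad \langle x,y\rangle+\langle y,x\rangle=0,$$ $$[x,[y,z]]+[y,[z,x]]+[z,[x,y]]=0,\qquad \langle x,\langle y,z\rangle\rangle+\langle y,\langle z,x\rangle\rangle+\langle z,\langle x,y\rangle\rangle=0,$$ $$[x,\langle y,z\rangle]+[y,\langle z,x\rangle]+[z,\langle x,y\rangle]+\langle x,[y,z]\rangle+\langle y,[z,x]\rangle+\langle z,[x,y]\rangle=0.$$ Let $\mathcal{L}ie_2(n)$ be its multilinear part, the $R$-submodule spanned by the bracket monomials that contain each letter of $X$ exactly once. Then $\mathcal{L}ie_2(n)$ is a free $R$-module of rank $n^{n-1}$. Moreover, an explicit basis is the following. For a rooted tree $G$ whose vertex set is a non-empty subset of $X$, with root $r$, define a bracket monomial $b_G$ recursively. If $G$ is the single vertex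 $r$, put $b_G=r$. Otherwise let $c_1<\dots<c_k$ be the vertices adjacent to $r$, and let $G_i$ be the subtree of $G$ with root $c_i$ formed by $c_i$ and its descendants; $G\setminus G_i$ is a rooted tree with root $r$. If $r<c_k$, let $c_i$ be the smallest of $c_1,\dots,c_k$ that is larger than $r$, and put $b_G=[\,b_{G\setminus G_i},\,b_{G_i}]$. If $r>c_k$, put $b_G=\langle b_{G_k},\,b_{G\setminus G_k}\rangle$. Then the monomials $b_G$, for $G$ running over all rooted trees with vertex set $X$, are pairwise distinct, there are $n^{n-1}$ of them, and (their images in the free algebra, indexed by the trees $G$) they form a basis of the $R$-module $\mathcal{L}ie_2(n)$. -/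

import Mathlib

namespace CompatibleLie

/-- The two brackets: `red` stands for `[·,·]` and `blue` stands for `⟨·,·⟩`. -/
inductive Color
  | red
  | blue

/-- Bracket monomials in the letters `X`, for two formal binary operations. -/
inductive Monomial (X : Type*)
  | var (x : X) : Monomial X
  | br (c : Color) (a b : Monomial X) : Monomial X

/-- The multiset of letters occurring in a monomial. -/
def Monomial.letters {X : Type*} : Monomial X → Multiset X
  | .var x => {x}
  | .br _ a b => a.letters + b.letters

/-- A monomial is multilinear if it contains each letter of `X` exactly once. -/
def Monomial.IsMultilinear {X : Type*} [DecidableEq X] (m : Monomial X) : Prop :=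
  ∀ x : X, m.letters.count x = 1

section FreeAlgebra

variable (R : Type*) [CommRing R] (X : Type*)

/-- The free `R`-module on all monomials: the free algebra on `X` with two bilinear operations
subject to no relations. -/
abbrev FreeBinary : Type _ := Monomial X →₀ R

/-- The bilinear operation of colour `c` on `FreeBinary R X`. -/
noncomputable def rawBracket (c : Color) :
    FreeBinary R X →ₗ[R] FreeBinary R X →ₗ[R] FreeBinary R X :=
  Finsupp.linearCombination R fun a : Monomial X =>
    Finsupp.linearCombination R fun b : Monomial X =>
      (Finsupp.single (Monomial.br c a b) (1 : R) : FreeBinary R X)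

variable {R X}

/-- Two-sided ideals for both operations. -/
def IsIdeal (I : Submodule R (FreeBinary R X)) : Prop :=
  ∀ (c : Color) (x y : FreeBinary R X), x ∈ I ∨ y ∈ I → rawBracket R X c x y ∈ I

/-- Modulo `I`, both operations are antisymmetric, satisfy the Jacobi identity, and satisfy the
mixed Jacobi identity. -/
structure ContainsRelations (I : Submodule R (FreeBinary R X)) : Prop where
  antisymm : ∀ (c : Color) (x y : FreeBinary R X),
    rawBracket R X c x y + rawBracket R X c y x ∈ I
  jacobi : ∀ (c : Color) (x y z : FreeBinary R X),
    rawBracket R X c x (rawBracket R X c y z) + rawBracket R X c y (rawBracket R X c z x)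
      + rawBracket R X c z (rawBracket R X c x y) ∈ I
  mixed_jacobi : ∀ x y z : FreeBinary R X,
    rawBracket R X .red x (rawBracket R X .blue y z)
      + rawBracket R X .red y (rawBracket R X .blue z x)
      + rawBracket R X .red z (rawBracket R X .blue x y)
      + rawBracket R X .blue x (rawBracket R X .red y z)
      + rawBracket R X .blue y (rawBracket R X .red z x)
      + rawBracket R X .blue z (rawBracket R X .red x y) ∈ I

variable (R X)

/-- The smallest two-sided ideal containing all the relations. -/
noncomputable def relIdeal : Submodule R (FreeBinary R X) :=
  sInf {I | IsIdeal I ∧ ContainsRelations I}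

theorem relIdeal_isIdeal : IsIdeal (relIdeal R X) := by
  intro c x y h
  refine (Submodule.mem_sInf).2 fun I hI => hI.1 c x y ?_
  exact h.imp (fun h => (Submodule.mem_sInf).1 h I hI) (fun h => (Submodule.mem_sInf).1 h I hI)

/-- The free algebra on `X` over `R` with two compatible Lie brackets. -/
abbrev FreeLie₂ : Type _ := FreeBinary R X ⧸ relIdeal R X

/-- The brackets induced on the free algebra: `bracket R X .red` is `[·,·]` and
`bracket R X .blue` is `⟨·,·⟩`. -/
noncomputable def bracket (c : Color) :
    FreeLie₂ R X →ₗ[R] FreeLie₂ R X →ₗ[R] FreeLie₂ R X :=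
  ((relIdeal R X).liftQ
    ((relIdeal R X).liftQ ((rawBracket R X c).compr₂ (relIdeal R X).mkQ) (by
      intro x hx
      refine LinearMap.mem_ker.2 (LinearMap.ext fun y => ?_)
      simpa using relIdeal_isIdeal R X c x y (Or.inl hx))).flip (by
    intro y hy
    refine LinearMap.mem_ker.2 (LinearMap.ext fun q => ?_)
    obtain ⟨x, rfl⟩ := (relIdeal R X).mkQ_surjective q
    simpa using relIdeal_isIdeal R X c x y (Or.inr hy))).flip

/-- The generator of the free algebra given by a letter. -/
noncomputable def gen (x : X) : FreeLie₂ R X :=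
  (relIdeal R X).mkQ (Finsupp.single (Monomial.var x) 1)

variable {X}

/-- The element of the free algebra denoted by a monomial. -/
noncomputable def Monomial.eval : Monomial X → FreeLie₂ R X
  | .var x => gen R X x
  | .br c a b => bracket R X c (Monomial.eval a) (Monomial.eval b)

variable (X)

/-- The multilinear part `Lie₂(n)` of the free algebra with two compatible Lie brackets: the
submodule spanned by the monomials that contain each letter exactly once. -/
noncomputable def multilinearPart [DecidableEq X] : Submodule R (FreeLie₂ R X) :=
  Submodule.span R {v | ∃ m : Monomial X, m.IsMultilinear ∧ m.eval R = v}

end FreeAlgebra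

section Trees

/-- Rooted trees with vertex set `X`: a tree on `X` with a distinguished vertex. -/
structure LabeledRootedTree (X : Type*) where
  graph : SimpleGraph X
  isTree : graph.IsTree
  root : X

variable {X : Type*} [Fintype X]

open Classical in
/-- The neighbours of `r` in `G`. -/
noncomputable def nbrs (G : SimpleGraph X) (r : X) : Finset X :=
  Finset.univ.filter fun c => G.Adj r c

theorem ncard_edgeSet_deleteEdges_lt (G : SimpleGraph X) {r c : X} (h : G.Adj r c) :
    (G.deleteEdges {s(r, c)}).edgeSet.ncard < G.edgeSet.ncard := by
  refine Set.ncard_lt_ncard ?_ (Set.toFinite _)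
  rw [SimpleGraph.edgeSet_deleteEdges]
  refine ⟨Set.sdiff_subset, fun hs => ?_⟩
  exact (hs (G.mem_edgeSet.2 h)).2 rfl

theorem adj_of_mem_nbrs {G : SimpleGraph X} {r c : X} (h : c ∈ nbrs G r) : G.Adj r c := by
  simpa [nbrs] using h

variable [LinearOrder X]

open Classical in
/-- The neighbours of `r` in `G` that are larger than `r`. When `r` is the root these are the
children of `r` joined to it by an increasing (red) edge. -/
noncomputable def upNbrs (G : SimpleGraph X) (r : X) : Finset X :=
  Finset.univ.filter fun c => G.Adj r c ∧ r < c

theorem adj_of_mem_upNbrs {G : SimpleGraph X} {r c : X} (h : c ∈ upNbrs G r) : G.Adj r c := by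
  have h' : G.Adj r c ∧ r < c := by simpa [upNbrs] using h
  exact h'.1

/-- The monomial `b` of the tree that is the connected component of `r` in the forest `G`, rooted
at `r`.  Deleting the edge between the root `r` and its child `c` splits that tree into the subtree
at `c` (the component of `c`) and the remaining tree with root `r` (the component of `r`).

* If some child of `r` is larger than `r`, let `c` be the smallest such child; the monomial is
  `[b (rest), b (subtree at c)]`.
* If `r` has children, all of them smaller than `r`, let `c` be the largest child; the monomial
  is `⟨b (subtree at c), b (rest)⟩`.
* If `r` has no child, the monomial is the letter `r`. -/
noncomputable def componentMonomial (G : SimpleGraph X) (r : X) : Monomial X :=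
  if h : (upNbrs G r).Nonempty then
    .br .red
      (componentMonomial (G.deleteEdges {s(r, (upNbrs G r).min' h)}) r)
      (componentMonomial (G.deleteEdges {s(r, (upNbrs G r).min' h)}) ((upNbrs G r).min' h))
  else if h' : (nbrs G r).Nonempty then
    .br .blue
      (componentMonomial (G.deleteEdges {s(r, (nbrs G r).max' h')}) ((nbrs G r).max' h'))
      (componentMonomial (G.deleteEdges {s(r, (nbrs G r).max' h')}) r)
  else .var r
termination_by G.edgeSet.ncard
decreasing_by
  · exact ncard_edgeSet_deleteEdges_lt G (adj_of_mem_upNbrs ((upNbrs G r).min'_mem h))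
  · exact ncard_edgeSet_deleteEdges_lt G (adj_of_mem_upNbrs ((upNbrs G r).min'_mem h))
  · exact ncard_edgeSet_deleteEdges_lt G (adj_of_mem_nbrs ((nbrs G r).max'_mem h'))
  · exact ncard_edgeSet_deleteEdges_lt G (adj_of_mem_nbrs ((nbrs G r).max'_mem h'))

/-- The monomial `b_T` of a rooted tree `T` on `X`. -/
noncomputable def LabeledRootedTree.monomial (T : LabeledRootedTree X) : Monomial X :=
  componentMonomial T.graph T.root

end Trees

end CompatibleLie

/-!
# A basis of the multilinear part of the free algebra with two compatible Lie brackets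

The monomials `b_G` are exactly the *normal* monomials (`Monomial.Normal`): those in which each
bracket `[a, b]` or `⟨a, b⟩` satisfies `root a < root b`, where the root of `[a, b]` is that of `a`
and the root of `⟨a, b⟩` is that of `b`, and in which the branches at each vertex are attached in
the prescribed order. Joining the roots of the two entries of each bracket recovers the tree `G`;
red edges increase and blue edges decrease away from the root (`componentMonomial_spec`,
`Monomial.Agrees.componentMonomial_eq`).

*Normal monomials span* (`eval_mem_normalSpan_of_nodup`). By induction on the number of letters it
is enough to straighten a bracket of two normal monomials. By the Jacobi identity two right
brackets commute up to a word with fewer operators, so a word of right red brackets can be sorted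
by the roots of its operators, unless one of these roots is smaller than the root of the base;
then that operator is moved to the front and becomes the entry with the smaller root. So red
brackets are straightened by induction on the smaller root (`SpansBelow.red_mem`). Blue brackets
are treated in the same way by downward induction on the larger root, where the mixed Jacobi
identity moves a blue bracket inside a red one (`SpansBelow.blue_mem`).

*Normal monomials are independent* (`linearIndependent_eval`). Each monomial `m` has a polynomial
`p(m)` in variables indexed by directed edges, given by `p(x) = 1` and
`p([a, b]_c) = ω_c(a, b) p(a) p(b)`, where `ω_c(a, b)` is the sum over the letters `x` of `a` and
`y` of `b` of an antisymmetric expression in the two letters, equal up to sign to the variable of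
the edge of colour `c` between them. Since `ω_c` is biadditive and antisymmetric, all relations of
the free algebra hold in this model (`relIdeal_le_ker_polyHom`). The coefficient in `p(m)` of the
tree of a normal `m` is `1` or `-1` (`isUnit_coeff_poly`), and if the tree of `m'` occurs in `p(m)`
then it *crosses* `m`: each bracket `[a, b]_c` of `m` corresponds to an edge of colour `c` between
the letters of `a` and those of `b` (`exists_crosses_of_coeff`). Independence follows once the
crossing relation on normal monomials is known to have no cycles, that is, once sequences in which
the tree of each monomial crosses the next one are eventually constant
(`IsCrossingSeq.eventually_const`). The reason is that the branch at the largest letter can only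
lose letters along such a sequence (`Grafting.subset_descendants`). When its set of letters is
constant, the branch and the rest of the tree form sequences of the same kind with fewer letters,
and the vertex to which the branch is attached moves towards the root
(`Grafting.crosses_restrict`). If the largest letter is the root, the smallest letter takes its
place.

*The number of trees* (`card_labeledRootedTree`). Cutting the edge from a vertex `v` to its parent
turns a rooted forest with roots `C` into one with roots `C ∪ {v}` and a vertex outside the tree of
`v`. By symmetry the trees at the different roots have the same average size, so this gives a
recursion on the number of roots, which is solved by `|C| n ^ (n - |C| - 1)`.
-/

namespace CompatibleLie

/-! ### Identities in the free algebra -/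

section Identities

variable (R : Type*) [CommRing R] (X : Type*)

theorem relIdeal_containsRelations : ContainsRelations (relIdeal R X) where
  antisymm c x y := (Submodule.mem_sInf).2 fun _ hI => hI.2.antisymm c x y
  jacobi c x y z := (Submodule.mem_sInf).2 fun _ hI => hI.2.jacobi c x y z
  mixed_jacobi x y z := (Submodule.mem_sInf).2 fun _ hI => hI.2.mixed_jacobi x y z

variable {X}

theorem bracket_mkQ (c : Color) (x y : FreeBinary R X) :
    bracket R X c ((relIdeal R X).mkQ x) ((relIdeal R X).mkQ y) =
      (relIdeal R X).mkQ (rawBracket R X c x y) := by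
  simp [bracket]

theorem bracket_add_swap (c : Color) (x y : FreeLie₂ R X) :
    bracket R X c x y + bracket R X c y x = 0 := by
  obtain ⟨x, rfl⟩ := (relIdeal R X).mkQ_surjective x
  obtain ⟨y, rfl⟩ := (relIdeal R X).mkQ_surjective y
  simp only [bracket_mkQ, ← map_add]
  exact (Submodule.Quotient.mk_eq_zero _).2 ((relIdeal_containsRelations R X).antisymm c x y)

theorem bracket_swap (c : Color) (x y : FreeLie₂ R X) :
    bracket R X c x y = -bracket R X c y x :=
  eq_neg_of_add_eq_zero_left (bracket_add_swap R c x y)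

theorem bracket_jacobi (c : Color) (x y z : FreeLie₂ R X) :
    bracket R X c x (bracket R X c y z) + bracket R X c y (bracket R X c z x)
      + bracket R X c z (bracket R X c x y) = 0 := by
  obtain ⟨x, rfl⟩ := (relIdeal R X).mkQ_surjective x
  obtain ⟨y, rfl⟩ := (relIdeal R X).mkQ_surjective y
  obtain ⟨z, rfl⟩ := (relIdeal R X).mkQ_surjective z
  simp only [bracket_mkQ, ← map_add]
  exact (Submodule.Quotient.mk_eq_zero _).2 ((relIdeal_containsRelations R X).jacobi c x y z)

theorem bracket_mixed_jacobi (x y z : FreeLie₂ R X) :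
    bracket R X .red x (bracket R X .blue y z)
      + bracket R X .red y (bracket R X .blue z x)
      + bracket R X .red z (bracket R X .blue x y)
      + bracket R X .blue x (bracket R X .red y z)
      + bracket R X .blue y (bracket R X .red z x)
      + bracket R X .blue z (bracket R X .red x y) = 0 := by
  obtain ⟨x, rfl⟩ := (relIdeal R X).mkQ_surjective x
  obtain ⟨y, rfl⟩ := (relIdeal R X).mkQ_surjective y
  obtain ⟨z, rfl⟩ := (relIdeal R X).mkQ_surjective z
  simp only [bracket_mkQ, ← map_add]
  exact (Submodule.Quotient.mk_eq_zero _).2 ((relIdeal_containsRelations R X).mixed_jacobi x y z)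

/-- Left multiplications by `x` and `y` commute up to left multiplication by their bracket. -/
theorem bracket_left_comm (c : Color) (x y v : FreeLie₂ R X) :
    bracket R X c x (bracket R X c y v) - bracket R X c y (bracket R X c x v) =
      bracket R X c (bracket R X c x y) v := by
  have h := bracket_jacobi R c x y v
  rw [bracket_swap R c v x, map_neg, bracket_swap R c v] at h
  rw [← sub_eq_zero, ← h]
  abel

/-- Right multiplications by `x` and `y` commute up to right multiplication by their bracket. -/
theorem bracket_right_comm (c : Color) (x y v : FreeLie₂ R X) :
    bracket R X c (bracket R X c v y) x - bracket R X c (bracket R X c v x) y =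
      bracket R X c v (bracket R X c y x) := by
  have h := bracket_jacobi R c x y v
  rw [bracket_swap R c x (bracket R X c y v), bracket_swap R c y (bracket R X c v x),
    bracket_swap R c y v, bracket_swap R c x y, map_neg, map_neg, LinearMap.neg_apply] at h
  rw [← sub_eq_zero, ← neg_eq_zero, ← neg_zero, ← h]
  abel

theorem eval_eq_mkQ (m : Monomial X) :
    m.eval R = (relIdeal R X).mkQ (Finsupp.single m 1) := by
  induction m with
  | var x => rfl
  | br c a b iha ihb =>
    rw [Monomial.eval, iha, ihb, bracket_mkQ]
    simp [rawBracket]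

end Identities

/-! ### A polynomial model -/

section Model

variable (R : Type*) [CommRing R] {X : Type*} [LinearOrder X]

/-- The antisymmetric form of colour `c` on letters. The variable indexed by the pair `(u, v)`
stands for an edge from the parent `u` to the child `v`; its colour is red if `u < v` and blue if
`v < u`, so that for each colour there is one variable for each pair of distinct letters. -/
noncomputable def edgeForm : Color → X → X → MvPolynomial (X × X) R
  | .red, x, y => if x < y then MvPolynomial.X (x, y) else
      if y < x then -MvPolynomial.X (y, x) else 0
  | .blue, x, y => if y < x then MvPolynomial.X (x, y) else
      if x < y then -MvPolynomial.X (y, x) else 0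

theorem edgeForm_swap (c : Color) (x y : X) : edgeForm R c y x = -edgeForm R c x y := by
  rcases lt_trichotomy x y with h | rfl | h
  · cases c <;> simp [edgeForm, h, h.not_gt]
  · cases c <;> simp [edgeForm]
  · cases c <;> simp [edgeForm, h, h.not_gt]

/-- The biadditive extension of `edgeForm` to multisets of letters. -/
noncomputable def crossForm (c : Color) (s t : Multiset X) : MvPolynomial (X × X) R :=
  (s.map fun x => (t.map fun y => edgeForm R c x y).sum).sum

theorem crossForm_add_right (c : Color) (s t t' : Multiset X) :
    crossForm R c s (t + t') = crossForm R c s t + crossForm R c s t' := by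
  simp [crossForm, Multiset.sum_map_add]

theorem crossForm_swap (c : Color) (s t : Multiset X) :
    crossForm R c t s = -crossForm R c s t := by
  simp only [crossForm]
  rw [Multiset.sum_map_sum_map, ← Multiset.sum_map_neg]
  refine congrArg _ (Multiset.map_congr rfl fun x _ => ?_)
  rw [← Multiset.sum_map_neg]
  exact congrArg _ (Multiset.map_congr rfl fun y _ => edgeForm_swap R c x y)

/-- The polynomial of a monomial: each of its brackets `[a, b]_c` contributes the factor
`crossForm c a.letters b.letters`, the signed sum of all edges of colour `c` that join `a` to
`b`. -/
noncomputable def Monomial.poly : Monomial X → MvPolynomial (X × X) R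
  | .var _ => 1
  | .br c a b => crossForm R c a.letters b.letters * (Monomial.poly a * Monomial.poly b)

variable (X) in
/-- The algebra on polynomials graded by multisets of letters in which the bracket of colour `c`
of `f` in degree `s` and `g` in degree `t` is `crossForm c s t * (f * g)` in degree `s + t`. -/
noncomputable def gradedBracket (c : Color) :
    (Multiset X →₀ MvPolynomial (X × X) R) →ₗ[R] (Multiset X →₀ MvPolynomial (X × X) R) →ₗ[R]
      (Multiset X →₀ MvPolynomial (X × X) R) :=
  Finsupp.lsum R fun s => LinearMap.flip (Finsupp.lsum R fun t =>
    ((LinearMap.mul R (MvPolynomial (X × X) R)).compr₂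
      (Finsupp.lsingle (s + t) ∘ₗ LinearMap.mulLeft R (crossForm R c s t))).flip)

theorem gradedBracket_single (c : Color) (s t : Multiset X) (f g : MvPolynomial (X × X) R) :
    gradedBracket R X c (Finsupp.single s f) (Finsupp.single t g) =
      Finsupp.single (s + t) (crossForm R c s t * (f * g)) := by
  simp [gradedBracket]

theorem gradedBracket_antisymm (c : Color) (x y : Multiset X →₀ MvPolynomial (X × X) R) :
    gradedBracket R X c x y + gradedBracket R X c y x = 0 := by
  induction x using Finsupp.induction_linear with
  | zero => simp
  | add x x' hx hx' =>
    simp only [map_add, LinearMap.add_apply]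
    rw [add_add_add_comm, hx, hx', add_zero]
  | single s f =>
  induction y using Finsupp.induction_linear with
  | zero => simp
  | add y y' hy hy' =>
    simp only [map_add, LinearMap.add_apply]
    rw [add_add_add_comm, hy, hy', add_zero]
  | single t g =>
  rw [gradedBracket_single, gradedBracket_single, add_comm t s, ← Finsupp.single_add,
    crossForm_swap R c s t]
  ring_nf
  simp

/-- The cyclic sum of `[x, [y, z]_d]_c`. -/
noncomputable def jacobiSum (c d : Color) (x y z : Multiset X →₀ MvPolynomial (X × X) R) :
    Multiset X →₀ MvPolynomial (X × X) R :=
  gradedBracket R X c x (gradedBracket R X d y z) + gradedBracket R X c y (gradedBracket R X d z x)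
    + gradedBracket R X c z (gradedBracket R X d x y)

theorem jacobiSum_add_left (c d : Color) (x x' y z : Multiset X →₀ MvPolynomial (X × X) R) :
    jacobiSum R c d (x + x') y z = jacobiSum R c d x y z + jacobiSum R c d x' y z := by
  simp only [jacobiSum, map_add, LinearMap.add_apply]
  abel

theorem jacobiSum_rotate (c d : Color) (x y z : Multiset X →₀ MvPolynomial (X × X) R) :
    jacobiSum R c d x y z = jacobiSum R c d y z x := by
  simp only [jacobiSum]
  abel

/-- The coefficient of the cyclic sum on homogeneous elements. -/
theorem jacobiSum_single (c d : Color) (s t u : Multiset X) (f g h : MvPolynomial (X × X) R) :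
    jacobiSum R c d (Finsupp.single s f) (Finsupp.single t g) (Finsupp.single u h) =
      Finsupp.single (s + t + u) ((crossForm R c s (t + u) * crossForm R d t u +
        crossForm R c t (u + s) * crossForm R d u s +
        crossForm R c u (s + t) * crossForm R d s t) * (f * g * h)) := by
  simp only [jacobiSum, gradedBracket_single]
  rw [show t + (u + s) = s + t + u by abel, show u + (s + t) = s + t + u by abel,
    show s + (t + u) = s + t + u by abel, ← Finsupp.single_add, ← Finsupp.single_add]
  congr 1
  ring

theorem jacobiSum_self_single (c : Color) (s t u : Multiset X)
    (f g h : MvPolynomial (X × X) R) :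
    jacobiSum R c c (Finsupp.single s f) (Finsupp.single t g) (Finsupp.single u h) = 0 := by
  rw [jacobiSum_single, crossForm_add_right, crossForm_add_right, crossForm_add_right,
    crossForm_swap R c s t, crossForm_swap R c t u, crossForm_swap R c u s,
    ← Finsupp.single_zero (s + t + u)]
  congr 1
  ring

theorem jacobiSum_mixed_single (c d : Color) (s t u : Multiset X)
    (f g h : MvPolynomial (X × X) R) :
    jacobiSum R c d (Finsupp.single s f) (Finsupp.single t g) (Finsupp.single u h) +
      jacobiSum R d c (Finsupp.single s f) (Finsupp.single t g) (Finsupp.single u h) = 0 := by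
  rw [jacobiSum_single, jacobiSum_single, ← Finsupp.single_add]
  simp only [crossForm_add_right]
  rw [crossForm_swap R c s t, crossForm_swap R c t u, crossForm_swap R c u s,
    crossForm_swap R d s t, crossForm_swap R d t u, crossForm_swap R d u s,
    ← Finsupp.single_zero (s + t + u)]
  congr 1
  ring

theorem gradedBracket_jacobi (c : Color) (x y z : Multiset X →₀ MvPolynomial (X × X) R) :
    jacobiSum R c c x y z = 0 := by
  induction x using Finsupp.induction_linear with
  | zero => simp [jacobiSum]
  | add x x' hx hx' => rw [jacobiSum_add_left, hx, hx', add_zero]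
  | single s f =>
  rw [jacobiSum_rotate]
  induction y using Finsupp.induction_linear with
  | zero => simp [jacobiSum]
  | add y y' hy hy' => rw [jacobiSum_add_left, hy, hy', add_zero]
  | single t g =>
  rw [jacobiSum_rotate]
  induction z using Finsupp.induction_linear with
  | zero => simp [jacobiSum]
  | add z z' hz hz' => rw [jacobiSum_add_left, hz, hz', add_zero]
  | single u h => exact jacobiSum_self_single R c u s t h f g

theorem gradedBracket_mixed_jacobi (c d : Color) (x y z : Multiset X →₀ MvPolynomial (X × X) R) :
    jacobiSum R c d x y z + jacobiSum R d c x y z = 0 := by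
  induction x using Finsupp.induction_linear with
  | zero => simp [jacobiSum]
  | add x x' hx hx' =>
    rw [jacobiSum_add_left, jacobiSum_add_left, add_add_add_comm, hx, hx', add_zero]
  | single s f =>
  rw [jacobiSum_rotate, jacobiSum_rotate R d c]
  induction y using Finsupp.induction_linear with
  | zero => simp [jacobiSum]
  | add y y' hy hy' =>
    rw [jacobiSum_add_left, jacobiSum_add_left, add_add_add_comm, hy, hy', add_zero]
  | single t g =>
  rw [jacobiSum_rotate, jacobiSum_rotate R d c]
  induction z using Finsupp.induction_linear with
  | zero => simp [jacobiSum]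
  | add z z' hz hz' =>
    rw [jacobiSum_add_left, jacobiSum_add_left, add_add_add_comm, hz, hz', add_zero]
  | single u h => exact jacobiSum_mixed_single R c d u s t h f g

variable (X) in
/-- The homomorphism from `FreeBinary R X` to the polynomial model that sends a letter `x` to
`1` in degree `{x}`. -/
noncomputable def polyHom : FreeBinary R X →ₗ[R] (Multiset X →₀ MvPolynomial (X × X) R) :=
  Finsupp.linearCombination R fun m => Finsupp.single m.letters (m.poly R)

theorem polyHom_rawBracket (c : Color) (x y : FreeBinary R X) :
    polyHom R X (rawBracket R X c x y) = gradedBracket R X c (polyHom R X x) (polyHom R X y) := by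
  induction x using Finsupp.induction_linear with
  | zero => simp
  | add x x' hx hx' => simp only [map_add, LinearMap.add_apply, hx, hx']
  | single a r =>
  induction y using Finsupp.induction_linear with
  | zero => simp
  | add y y' hy hy' => simp only [map_add, hy, hy']
  | single b q =>
    simp only [polyHom, rawBracket, Finsupp.linearCombination_single, LinearMap.smul_apply,
      map_smul, gradedBracket_single, Monomial.poly, Monomial.letters, one_smul]
    rw [smul_comm]

theorem relIdeal_le_ker_polyHom : relIdeal R X ≤ LinearMap.ker (polyHom R X) := by
  refine sInf_le ⟨fun c x y h => ?_, fun c x y => ?_, fun c x y z => ?_, fun x y z => ?_⟩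
  · rw [LinearMap.mem_ker, polyHom_rawBracket]
    rcases h with h | h <;> rw [LinearMap.mem_ker] at h <;> simp [h]
  · rw [LinearMap.mem_ker, map_add, polyHom_rawBracket, polyHom_rawBracket,
      gradedBracket_antisymm]
  · rw [LinearMap.mem_ker]
    simp only [map_add, polyHom_rawBracket]
    exact gradedBracket_jacobi R c _ _ _
  · rw [LinearMap.mem_ker]
    simp only [map_add, polyHom_rawBracket]
    rw [← gradedBracket_mixed_jacobi R .red .blue (polyHom R X x) (polyHom R X y)
      (polyHom R X z)]
    simp only [jacobiSum]
    abel

/-- The linear functional on the free algebra that extracts, from the component of degree `s` of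
the image in the polynomial model, the coefficient at `D`. -/
noncomputable def coeffFunctional (s : Multiset X) (D : X × X →₀ ℕ) : FreeLie₂ R X →ₗ[R] R :=
  (MvPolynomial.lcoeff R D ∘ₗ Finsupp.lapply s) ∘ₗ
    (relIdeal R X).liftQ (polyHom R X) (relIdeal_le_ker_polyHom R)

theorem coeffFunctional_eval (D : X × X →₀ ℕ) (m : Monomial X) :
    coeffFunctional R m.letters D (m.eval R) = (m.poly R).coeff D := by
  rw [eval_eq_mkQ]
  simp [coeffFunctional, polyHom]

end Model

/-! ### Normal monomials -/

section Normal

variable {X : Type*}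

/-- The root of a monomial: the left root for a red bracket, the right root for a blue one. -/
def Monomial.root : Monomial X → X
  | .var x => x
  | .br .red a _ => a.root
  | .br .blue _ b => b.root

theorem Monomial.root_mem_letters (m : Monomial X) : m.root ∈ m.letters := by
  induction m with
  | var x => simp [root, letters]
  | br c a b iha ihb => cases c <;> simp [root, letters, iha, ihb]

theorem Monomial.card_letters_pos (m : Monomial X) : 0 < m.letters.card :=
  Multiset.card_pos_iff_exists_mem.2 ⟨_, m.root_mem_letters⟩

/-- The total multiset of letters of a list of monomials. -/
def lettersSum (L : List (Monomial X)) : Multiset X := (L.map Monomial.letters).sum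

@[simp] theorem lettersSum_nil : lettersSum ([] : List (Monomial X)) = 0 := rfl

@[simp] theorem lettersSum_cons (a : Monomial X) (L : List (Monomial X)) :
    lettersSum (a :: L) = a.letters + lettersSum L := by simp [lettersSum]

@[simp] theorem lettersSum_append (L L' : List (Monomial X)) :
    lettersSum (L ++ L') = lettersSum L + lettersSum L' := by simp [lettersSum]

theorem lettersSum_perm {L L' : List (Monomial X)} (h : L.Perm L') :
    lettersSum L = lettersSum L' :=
  (h.map _).sum_eq

theorem disjoint_letters {a b : Monomial X} {s : Multiset X} (hs : s.Nodup)
    (h : a.letters + b.letters = s) : Disjoint a.letters b.letters := by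
  subst h
  exact (Multiset.nodup_add.1 hs).2.2

theorem root_ne_root {a b : Monomial X} {s : Multiset X} (hs : s.Nodup)
    (h : a.letters + b.letters = s) : a.root ≠ b.root := fun heq =>
  Multiset.disjoint_left.1 (disjoint_letters hs h) a.root_mem_letters
    (heq ▸ b.root_mem_letters)

/-- In a list of monomials without common letters the roots are distinct. -/
theorem pairwise_root_ne {L : List (Monomial X)} (h : (lettersSum L).Nodup) :
    L.Pairwise fun a b => a.root ≠ b.root := by
  induction L with
  | nil => exact List.Pairwise.nil
  | cons a L ih =>
    rw [lettersSum_cons, Multiset.nodup_add] at h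
    refine List.pairwise_cons.2 ⟨fun b hb heq => ?_, ih h.2.1⟩
    refine Multiset.disjoint_left.1 h.2.2 a.root_mem_letters (heq ▸ ?_)
    have : b.letters ≤ lettersSum L := List.single_le_sum (by simp) _ (List.mem_map_of_mem hb)
    exact Multiset.mem_of_le this b.root_mem_letters

theorem root_mem_lettersSum {L : List (Monomial X)} {a : Monomial X} (h : a ∈ L) :
    a.root ∈ lettersSum L :=
  Multiset.mem_of_le (List.single_le_sum (by simp) _ (List.mem_map_of_mem h)) a.root_mem_letters

variable [LinearOrder X]

/-- `b` may be attached to `m` by a red bracket `[m, b]` with `c = b.root`, as far as the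
outermost bracket of `m` is concerned: if `m = [p, q]` then `c < q.root`. -/
def Monomial.RedBound (c : X) : Monomial X → Prop
  | .br .red _ b => c < b.root
  | _ => True

/-- `b` may be attached to `m` by a blue bracket `⟨b, m⟩` with `c = b.root`, as far as the
outermost bracket of `m` is concerned: `m` is not a red bracket, and if `m = ⟨p, q⟩` then
`p.root < c`. -/
def Monomial.BlueBound (c : X) : Monomial X → Prop
  | .var _ => True
  | .br .red _ _ => False
  | .br .blue a _ => a.root < c

/-- Normal monomials: these are the monomials `b_G` of rooted trees `G`, in terms of brackets.
The conditions on the outermost bracket say that the branch split off last is the one prescribed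
for the tree: the smallest red child of the root if there is one, and otherwise the largest blue
child. -/
def Monomial.Normal : Monomial X → Prop
  | .var _ => True
  | .br .red a b => a.Normal ∧ b.Normal ∧ a.root < b.root ∧ a.RedBound b.root
  | .br .blue a b => a.Normal ∧ b.Normal ∧ a.root < b.root ∧ b.BlueBound a.root

end Normal

/-! ### Normal monomials span -/

section Spanning

variable (R : Type*) [CommRing R] {X : Type*} [LinearOrder X]

/-- The span of the normal monomials with multiset of letters `s`. -/
noncomputable def normalSpan (s : Multiset X) : Submodule R (FreeLie₂ R X) :=
  Submodule.span R {v | ∃ m : Monomial X, m.Normal ∧ m.letters = s ∧ m.eval R = v}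

variable {R}

theorem eval_mem_normalSpan {m : Monomial X} (h : m.Normal) :
    m.eval R ∈ normalSpan R m.letters :=
  Submodule.subset_span ⟨m, h, rfl, rfl⟩

/-- A linear map carries `normalSpan R s` into `V` if it does so for normal monomials. -/
theorem map_mem_of_mem_normalSpan {M : Type*} [AddCommGroup M] [Module R M]
    {s : Multiset X} (V : Submodule R M) (f : FreeLie₂ R X →ₗ[R] M)
    (h : ∀ m : Monomial X, m.Normal → m.letters = s → f (m.eval R) ∈ V)
    {v : FreeLie₂ R X} (hv : v ∈ normalSpan R s) : f v ∈ V := by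
  have : normalSpan R s ≤ V.comap f := by
    refine Submodule.span_le.2 ?_
    rintro _ ⟨m, hm, hs, rfl⟩
    exact h m hm hs
  exact this hv

variable (R) in
/-- Brackets of normal monomials with fewer than `N` letters in total, all distinct, are
combinations of normal monomials. -/
def SpansBelow (X : Type*) [LinearOrder X] (N : ℕ) : Prop :=
  ∀ (c : Color) (a b : Monomial X), a.Normal → b.Normal → (a.letters + b.letters).Nodup →
    (a.letters + b.letters).card < N → bracket R X c (a.eval R) (b.eval R) ∈
      normalSpan R (a.letters + b.letters)

theorem SpansBelow.bracket_mem {N : ℕ} (hN : SpansBelow R X N) (c : Color) {s t : Multiset X}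
    (hst : (s + t).Nodup) (hc : (s + t).card < N) {x y : FreeLie₂ R X} (hx : x ∈ normalSpan R s)
    (hy : y ∈ normalSpan R t) : bracket R X c x y ∈ normalSpan R (s + t) := by
  refine map_mem_of_mem_normalSpan _ ((bracket R X c).flip y) (fun a ha has => ?_) hx
  refine map_mem_of_mem_normalSpan _ (bracket R X c (a.eval R)) (fun b hb hbt => ?_) hy
  subst has hbt
  exact hN c a b ha hb hst hc

/-- The word `E₁ ⋯ Eₖ` of operators applied to `v`. -/
noncomputable def applyWord (op : FreeLie₂ R X →ₗ[R] FreeLie₂ R X →ₗ[R] FreeLie₂ R X)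
    (v : FreeLie₂ R X) (L : List (Monomial X)) : FreeLie₂ R X :=
  L.foldr (fun a w => op (a.eval R) w) v

section Word

variable {op : FreeLie₂ R X →ₗ[R] FreeLie₂ R X →ₗ[R] FreeLie₂ R X}
  {β : FreeLie₂ R X → FreeLie₂ R X → FreeLie₂ R X} {v₀ : FreeLie₂ R X} {s₀ : Multiset X}
  {s : Multiset X}

variable (op v₀ s₀ s) in
/-- All words of less than `k` operators with total multiset of letters `s` give combinations of
normal monomials. -/
def WordsSpanBelow (k : ℕ) : Prop :=
  ∀ L : List (Monomial X), L.length < k → (∀ a ∈ L, a.Normal) → lettersSum L + s₀ = s →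
    applyWord op v₀ L ∈ normalSpan R s

/-- In a word of operators, one of them may be replaced by any combination of normal monomials. -/
theorem WordsSpanBelow.insert_mem {k : ℕ} (hk : WordsSpanBelow op v₀ s₀ s k)
    (L₁ L₂ : List (Monomial X)) {t : Multiset X} (hlen : L₁.length + L₂.length + 1 < k)
    (h₁ : ∀ a ∈ L₁, a.Normal) (h₂ : ∀ a ∈ L₂, a.Normal)
    (hs : lettersSum L₁ + t + lettersSum L₂ + s₀ = s) {x : FreeLie₂ R X}
    (hx : x ∈ normalSpan R t) :
    applyWord op (op x (applyWord op v₀ L₂)) L₁ ∈ normalSpan R s := by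
  let F : FreeLie₂ R X →ₗ[R] FreeLie₂ R X :=
    L₁.foldr (fun a f => op (a.eval R) ∘ₗ f) (op.flip (applyWord op v₀ L₂))
  have hF : ∀ y, F y = applyWord op (op y (applyWord op v₀ L₂)) L₁ := by
    intro y
    simp only [F]
    clear F hs hlen h₁
    induction L₁ with
    | nil => rfl
    | cons a L ih =>
      rw [List.foldr_cons, LinearMap.comp_apply, ih]
      rfl
  rw [← hF]
  refine map_mem_of_mem_normalSpan _ F (fun a ha hat => ?_) hx
  rw [hF]
  have := hk (L₁ ++ a :: L₂) (by simp; omega) (by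
    intro b hb
    rcases List.mem_append.1 hb with hb | hb
    · exact h₁ b hb
    · rcases List.mem_cons.1 hb with rfl | hb
      · exact ha
      · exact h₂ b hb) (by rw [← hs, ← hat]; simp; abel)
  simpa [applyWord] using this

/-- Permuting the operators in a word changes the result by shorter words. -/
theorem applyWord_perm {N k : ℕ} (hN : SpansBelow R X N) {c : Color}
    (hcomm : ∀ x y v, op x (op y v) - op y (op x v) = op (β x y) v)
    (hβ : ∀ x y, β x y = bracket R X c x y ∨ β x y = bracket R X c y x)
    (hs₀ : 0 < s₀.card) (hsN : s.card ≤ N) (hs : s.Nodup)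
    (hk : WordsSpanBelow op v₀ s₀ s k) {L L' : List (Monomial X)} (hL : L.Perm L') :
    ∀ pre : List (Monomial X), pre.length + L.length ≤ k → (∀ a ∈ pre, a.Normal) →
      (∀ a ∈ L, a.Normal) → lettersSum pre + lettersSum L + s₀ = s →
      applyWord op v₀ (pre ++ L) - applyWord op v₀ (pre ++ L') ∈ normalSpan R s := by
  induction hL with
  | nil => intro pre _ _ _ _; simp
  | cons a h ih =>
    intro pre hlen hpre hn hsum
    have := ih (pre ++ [a]) (by simp at hlen ⊢; omega) (by
      intro b hb
      rcases List.mem_append.1 hb with hb | hb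
      · exact hpre b hb
      · exact hn b (by simp at hb; simp [hb])) (fun b hb => hn b (by simp [hb]))
      (by rw [← hsum]; simp; abel)
    simpa using this
  | swap a b L =>
    intro pre hlen hpre hn hsum
    have key : applyWord op v₀ (pre ++ b :: a :: L) - applyWord op v₀ (pre ++ a :: b :: L) =
        applyWord op (op (β (b.eval R) (a.eval R)) (applyWord op v₀ L)) pre := by
      clear hlen hpre hsum
      induction pre with
      | nil => simpa [applyWord] using hcomm _ _ _
      | cons p pre ih =>
        simp only [applyWord, List.cons_append, List.foldr_cons] at ih ⊢
        rw [← map_sub, ih]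
    rw [key]
    have hnd : (b.letters + a.letters).Nodup := by
      refine Multiset.nodup_of_le ?_ hs
      rw [← hsum, Multiset.le_iff_exists_add]
      exact ⟨lettersSum pre + lettersSum L + s₀, by simp; abel⟩
    have hcard : (b.letters + a.letters).card < N := by
      refine lt_of_lt_of_le ?_ hsN
      rw [← hsum]
      simp
      omega
    refine hk.insert_mem pre L (t := b.letters + a.letters) (by simp at hlen; omega) hpre
      (fun x hx => hn x (by simp [hx])) (by rw [← hsum]; simp; abel) ?_
    have ha := eval_mem_normalSpan (R := R) (hn a (by simp))
    have hb := eval_mem_normalSpan (R := R) (hn b (by simp))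
    rcases hβ (b.eval R) (a.eval R) with h | h <;> rw [h]
    · exact hN.bracket_mem c hnd hcard hb ha
    · rw [add_comm] at hnd hcard ⊢
      exact hN.bracket_mem c hnd hcard ha hb
  | trans h₁ h₂ ih₁ ih₂ =>
    intro pre hlen hpre hn hsum
    have h2 := ih₂ pre (by rw [← h₁.length_eq]; exact hlen) hpre
      (fun a ha => hn a (h₁.mem_iff.2 ha)) (by rw [← lettersSum_perm h₁]; exact hsum)
    have h1 := ih₁ pre hlen hpre hn hsum
    simpa using add_mem h1 h2

/-- Words of operators give combinations of normal monomials, provided that they do so when the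
operators are sorted and when the first operator is exceptional (`P`). -/
theorem applyWord_mem {N : ℕ} (hN : SpansBelow R X N) {c : Color}
    (hcomm : ∀ x y v, op x (op y v) - op y (op x v) = op (β x y) v)
    (hβ : ∀ x y, β x y = bracket R X c x y ∨ β x y = bracket R X c y x)
    (hop : ∀ x y, op x y = bracket R X c x y ∨ op x y = bracket R X c y x)
    (hs₀ : 0 < s₀.card) (hv₀ : v₀ ∈ normalSpan R s₀) (hsN : s.card ≤ N) (hs : s.Nodup)
    (P : Monomial X → Prop) (le : Monomial X → Monomial X → Prop) [DecidableRel le] [Std.Total le]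
    [IsTrans (Monomial X) le]
    (hP : ∀ (a : Monomial X) (t : Multiset X) (x : FreeLie₂ R X), a.Normal → P a →
      a.letters + t = s → x ∈ normalSpan R t → op (a.eval R) x ∈ normalSpan R s)
    (hsorted : ∀ L : List (Monomial X), (∀ a ∈ L, a.Normal) → (∀ a ∈ L, ¬ P a) →
      L.Pairwise le → lettersSum L + s₀ = s → applyWord op v₀ L ∈ normalSpan R s)
    (L : List (Monomial X)) (hL : ∀ a ∈ L, a.Normal) (hsum : lettersSum L + s₀ = s) :
    applyWord op v₀ L ∈ normalSpan R s := by
  -- Shorter words whose letters form a proper part of `s` are covered by `hN`.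
  have hpartial : ∀ L : List (Monomial X), (∀ a ∈ L, a.Normal) → (lettersSum L + s₀).Nodup →
      (lettersSum L + s₀).card < N → applyWord op v₀ L ∈ normalSpan R (lettersSum L + s₀) := by
    intro L
    induction L with
    | nil => intro _ _ _; simpa [applyWord] using hv₀
    | cons a L ih =>
      intro hn hnd hc
      have heq : lettersSum (a :: L) + s₀ = a.letters + (lettersSum L + s₀) := by simp; abel
      rw [heq] at hnd hc ⊢
      have hx := ih (fun b hb => hn b (by simp [hb]))
        (Multiset.nodup_of_le (Multiset.le_add_left _ _) hnd) (by simp at hc ⊢; omega)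
      have ha := eval_mem_normalSpan (R := R) (hn a (by simp))
      change op _ (applyWord op v₀ L) ∈ _
      rcases hop (a.eval R) (applyWord op v₀ L) with h | h <;> rw [h]
      · exact hN.bracket_mem c hnd hc ha hx
      · rw [add_comm] at hnd hc ⊢
        exact hN.bracket_mem c hnd hc hx ha
  suffices h : ∀ k, WordsSpanBelow op v₀ s₀ s k from
    h (L.length + 1) L (Nat.lt_succ_self _) hL hsum
  intro k
  induction k with
  | zero => intro L hL; omega
  | succ k ih =>
    intro L hlen hL hsum
    by_cases hex : ∃ a ∈ L, P a
    -- An exceptional operator is moved to the front; otherwise the word is sorted.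
    · obtain ⟨a, haL, hPa⟩ := hex
      obtain ⟨L₁, L₂, rfl⟩ := List.append_of_mem haL
      have hperm : (L₁ ++ a :: L₂).Perm (a :: (L₁ ++ L₂)) := List.perm_middle
      have hdiff := applyWord_perm hN hcomm hβ hs₀ hsN hs ih hperm [] (by simp at hlen ⊢; omega)
        (by simp) hL (by simpa using hsum)
      have hsum' : a.letters + (lettersSum (L₁ ++ L₂) + s₀) = s := by
        rw [← hsum, lettersSum_perm hperm, lettersSum_cons, add_assoc]
      have ha := a.card_letters_pos
      have hx := hpartial (L₁ ++ L₂) (fun b hb => hL b (hperm.mem_iff.2 (by simp [hb])))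
        (Multiset.nodup_of_le (by rw [← hsum']; exact Multiset.le_add_left _ _) hs) (by
          have := congrArg Multiset.card hsum'
          rw [Multiset.card_add] at this
          omega)
      have hmem : applyWord op v₀ (a :: (L₁ ++ L₂)) ∈ normalSpan R s :=
        hP a _ _ (hL a haL) hPa hsum' hx
      simpa using add_mem hdiff hmem
    · push Not at hex
      have hperm := (List.perm_insertionSort le L).symm
      have hdiff := applyWord_perm hN hcomm hβ hs₀ hsN hs ih hperm [] (by simp; omega) (by simp)
        hL (by simpa using hsum)
      have hmem := hsorted (L.insertionSort le) (fun a ha => hL a (hperm.mem_iff.2 ha))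
        (fun a ha => hex a (hperm.mem_iff.2 ha)) (List.pairwise_insertionSort le L)
        (by rw [← lettersSum_perm hperm]; exact hsum)
      simpa using add_mem hdiff hmem

end Word

variable (R)

/-- A normal monomial arises from one that is not a red bracket by bracketing with normal
monomials on the right. -/
theorem exists_red_word (m : Monomial X) (hm : m.Normal) :
    ∃ (B : Monomial X) (L : List (Monomial X)), B.Normal ∧ (∀ c, B.RedBound c) ∧
      B.root = m.root ∧ (∀ a ∈ L, a.Normal) ∧ lettersSum L + B.letters = m.letters ∧
      applyWord (bracket R X .red).flip (B.eval R) L = m.eval R := by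
  induction m with
  | var x => exact ⟨.var x, [], trivial, fun _ => trivial, rfl, by simp, by simp, rfl⟩
  | br c a b iha _ =>
    cases c with
    | blue => exact ⟨.br .blue a b, [], hm, fun _ => trivial, rfl, by simp, by simp, rfl⟩
    | red =>
      obtain ⟨B, L, hB, hBr, hroot, hL, hlet, hev⟩ := iha hm.1
      refine ⟨B, b :: L, hB, hBr, hroot, ?_, ?_, ?_⟩
      · simpa using ⟨hm.2.1, hL⟩
      · simp only [lettersSum_cons, Monomial.letters, ← hlet]
        abel
      · simp only [applyWord, List.foldr_cons, Monomial.eval, ← hev, LinearMap.flip_apply]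

/-- A sorted word of right red brackets is a normal monomial. -/
theorem exists_normal_of_red_word {B : Monomial X} (hB : B.Normal) (hBr : ∀ c, B.RedBound c)
    (L : List (Monomial X)) (hL : ∀ a ∈ L, a.Normal) (hlt : ∀ a ∈ L, B.root < a.root)
    (hsort : L.Pairwise fun a b => a.root < b.root) :
    ∃ m : Monomial X, m.Normal ∧ m.root = B.root ∧ (∀ c, (∀ a ∈ L, c < a.root) → m.RedBound c) ∧
      lettersSum L + B.letters = m.letters ∧
      applyWord (bracket R X .red).flip (B.eval R) L = m.eval R := by
  induction L with
  | nil => exact ⟨B, hB, rfl, fun c _ => hBr c, by simp, rfl⟩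
  | cons a L ih =>
    obtain ⟨m, hm, hroot, hbound, hlet, hev⟩ := ih (fun b hb => hL b (by simp [hb]))
      (fun b hb => hlt b (by simp [hb])) (List.pairwise_cons.1 hsort).2
    refine ⟨.br .red m a, ⟨hm, hL a (by simp), ?_, hbound _ (List.pairwise_cons.1 hsort).1⟩,
      hroot, fun c hc => hc a (by simp), ?_, ?_⟩
    · rw [hroot]
      exact hlt a (by simp)
    · simp only [lettersSum_cons, Monomial.letters, ← hlet]
      abel
    · simp only [applyWord, List.foldr_cons, Monomial.eval, ← hev, LinearMap.flip_apply]

/-- A monomial that is not a red bracket arises from its root by bracketing with normal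
monomials on the left. -/
theorem exists_blue_word (m : Monomial X) (hm : m.Normal) (hr : ∀ a b, m ≠ .br .red a b) :
    ∃ L : List (Monomial X), (∀ a ∈ L, a.Normal) ∧ lettersSum L + {m.root} = m.letters ∧
      applyWord (bracket R X .blue) (gen R X m.root) L = m.eval R := by
  induction m with
  | var x => exact ⟨[], by simp, by simp [Monomial.letters, Monomial.root], rfl⟩
  | br c a b _ ihb =>
    cases c with
    | red => exact absurd rfl (hr a b)
    | blue =>
      obtain ⟨L, hL, hlet, hev⟩ := ihb hm.2.1 (by
        rintro p q rfl
        exact hm.2.2.2)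
      refine ⟨a :: L, by simpa using ⟨hm.1, hL⟩, ?_, ?_⟩
      · simp only [lettersSum_cons, Monomial.letters, Monomial.root, ← hlet]
        abel
      · simp only [applyWord, List.foldr_cons, Monomial.eval, ← hev, Monomial.root]

/-- A sorted word of left blue brackets is a normal monomial. -/
theorem exists_normal_of_blue_word (r : X) (L : List (Monomial X)) (hL : ∀ a ∈ L, a.Normal)
    (hlt : ∀ a ∈ L, a.root < r) (hsort : L.Pairwise fun a b => b.root < a.root) :
    ∃ m : Monomial X, m.Normal ∧ m.root = r ∧ (∀ c, (∀ a ∈ L, a.root < c) → m.BlueBound c) ∧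
      lettersSum L + {r} = m.letters ∧
      applyWord (bracket R X .blue) (gen R X r) L = m.eval R := by
  induction L with
  | nil => exact ⟨.var r, trivial, rfl, fun c _ => trivial, by simp [Monomial.letters], rfl⟩
  | cons a L ih =>
    obtain ⟨m, hm, hroot, hbound, hlet, hev⟩ := ih (fun b hb => hL b (by simp [hb]))
      (fun b hb => hlt b (by simp [hb])) (List.pairwise_cons.1 hsort).2
    refine ⟨.br .blue a m, ⟨hL a (by simp), hm, ?_, hbound _ (List.pairwise_cons.1 hsort).1⟩,
      hroot, fun c hc => hc a (by simp), ?_, ?_⟩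
    · rw [hroot]
      exact hlt a (by simp)
    · simp only [lettersSum_cons, Monomial.letters, ← hlet]
      abel
    · simp only [applyWord, List.foldr_cons, Monomial.eval, ← hev]

variable {R}

variable [Finite X]

/-- Red brackets of normal monomials are straightened by induction on the smaller root. -/
theorem SpansBelow.red_mem {N : ℕ} (hN : SpansBelow R X N) {s : Multiset X} (hs : s.Nodup)
    (hsN : s.card ≤ N) (a b : Monomial X) (ha : a.Normal) (hb : b.Normal)
    (hab : a.letters + b.letters = s) :
    bracket R X .red (a.eval R) (b.eval R) ∈ normalSpan R s := by
  suffices H : ∀ r : X, ∀ a b : Monomial X, a.Normal → b.Normal → a.letters + b.letters = s →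
      a.root = r → r < b.root → bracket R X .red (a.eval R) (b.eval R) ∈ normalSpan R s by
    rcases lt_or_gt_of_ne (root_ne_root hs hab) with h | h
    · exact H _ a b ha hb hab rfl h
    · rw [bracket_swap]
      exact neg_mem (H _ b a hb ha (by rw [add_comm, hab]) rfl h)
  clear! a b
  intro r
  induction r using WellFoundedLT.induction with
  | ind r IH =>
  -- Brackets with an entry whose root is below `r` are covered by the induction hypothesis.
  have hsmall : ∀ a b : Monomial X, a.Normal → b.Normal → a.letters + b.letters = s →
      b.root < r → bracket R X .red (a.eval R) (b.eval R) ∈ normalSpan R s := by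
    intro a b ha hb hab hbr
    rcases lt_or_gt_of_ne (root_ne_root hs hab) with h | h
    · exact IH _ (h.trans hbr) a b ha hb hab rfl h
    · rw [bracket_swap]
      exact neg_mem (IH _ hbr b a hb ha (by rw [add_comm, hab]) rfl h)
  intro a b ha hb hab har hbr
  -- With `a = [⋯[B, eₖ], ⋯, e₁]` the bracket `[a, b]` is a word of right brackets applied to `B`.
  obtain ⟨B, L, hB, hBr, hroot, hL, hlet, hev⟩ := exists_red_word R a ha
  have hword : applyWord (bracket R X .red).flip (B.eval R) (b :: L) ∈ normalSpan R s := by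
    let _ : DecidableRel fun a b : Monomial X => a.root ≤ b.root := fun a b =>
      inferInstanceAs (Decidable (a.root ≤ b.root))
    have _ : Std.Total fun a b : Monomial X => a.root ≤ b.root := ⟨fun a b => le_total _ _⟩
    have _ : IsTrans (Monomial X) fun a b => a.root ≤ b.root := ⟨fun a b c => le_trans⟩
    refine applyWord_mem (op := (bracket R X .red).flip)
      (β := fun x y => bracket R X .red y x) (c := .red) hN
      (fun x y v => bracket_right_comm R .red x y v) (fun x y => Or.inr rfl)
      (fun x y => Or.inr rfl) B.card_letters_pos (eval_mem_normalSpan hB) hsN hs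
      (fun a => a.root < r) (fun a b => a.root ≤ b.root) ?_ ?_ _ ?_ ?_
    · intro e t x he her het hx
      refine map_mem_of_mem_normalSpan _ ((bracket R X .red).flip (e.eval R))
        (fun m hm hmt => ?_) hx
      exact hsmall m e hm he (by rw [hmt, add_comm, het]) her
    · intro L hL hP hsort hsum
      have hnd : (lettersSum L).Nodup :=
        Multiset.nodup_of_le (by rw [← hsum]; exact Multiset.le_add_right _ _) hs
      rw [← hsum] at hs
      obtain ⟨m, hm, -, -, hml, hme⟩ := exists_normal_of_red_word R hB hBr L hL
        (fun e he => by
          refine lt_of_le_of_ne (by rw [hroot, har]; exact not_lt.1 (hP e he)) fun heq => ?_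
          exact Multiset.disjoint_left.1 (Multiset.nodup_add.1 hs).2.2
            (root_mem_lettersSum he) (heq ▸ B.root_mem_letters))
        ((hsort.and (pairwise_root_ne hnd)).imp fun h => lt_of_le_of_ne h.1 h.2)
      rw [hme, ← hsum, hml]
      exact eval_mem_normalSpan hm
    · simpa using ⟨hb, hL⟩
    · rw [← hab, ← hlet, lettersSum_cons]
      abel
  rw [← hev]
  exact hword

/-- Blue brackets of normal monomials are straightened by downward induction on the larger root
`r`, and then by induction on the monomial `b` with root `r`. If `b` is a red bracket, the mixed
Jacobi identity is used, otherwise words of left blue brackets are sorted. -/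
theorem SpansBelow.blue_mem {N : ℕ} (hN : SpansBelow R X N) {s : Multiset X} (hs : s.Nodup)
    (hsN : s.card ≤ N) (a b : Monomial X) (ha : a.Normal) (hb : b.Normal)
    (hab : a.letters + b.letters = s) :
    bracket R X .blue (a.eval R) (b.eval R) ∈ normalSpan R s := by
  suffices H : ∀ r : X, ∀ b a : Monomial X, a.Normal → b.Normal → a.letters + b.letters = s →
      b.root = r → a.root < r → bracket R X .blue (a.eval R) (b.eval R) ∈ normalSpan R s by
    rcases lt_or_gt_of_ne (root_ne_root hs hab) with h | h
    · exact H _ b a ha hb hab rfl h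
    · rw [bracket_swap]
      exact neg_mem (H _ a b hb ha (by rw [add_comm, hab]) rfl h)
  clear! a b
  intro r
  induction r using WellFoundedGT.induction with
  | ind r IH =>
  -- Brackets with an entry whose root is above `r` are covered by the induction hypothesis.
  have hbig : ∀ a b : Monomial X, a.Normal → b.Normal → a.letters + b.letters = s →
      r < a.root → bracket R X .blue (a.eval R) (b.eval R) ∈ normalSpan R s := by
    intro a b ha hb hab har
    rcases lt_or_gt_of_ne (root_ne_root hs hab) with h | h
    · exact IH _ (har.trans h) b a ha hb hab rfl h
    · rw [bracket_swap]
      exact neg_mem (IH _ har a b hb ha (by rw [add_comm, hab]) rfl h)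
  have hbig_span : ∀ (a : Monomial X) (t : Multiset X) (x : FreeLie₂ R X), a.Normal →
      r < a.root → a.letters + t = s → x ∈ normalSpan R t →
      bracket R X .blue (a.eval R) x ∈ normalSpan R s := by
    intro e t x he her het hx
    refine map_mem_of_mem_normalSpan _ (bracket R X .blue (e.eval R)) (fun m hm hmt => ?_) hx
    exact hbig e m he hm (by rw [hmt, het]) her
  intro b
  induction b with
  | var x =>
    intro a ha hb hab hbr har
    have : (Monomial.br .blue a (.var x)).Normal := ⟨ha, hb, by rw [hbr]; exact har, trivial⟩
    have h := eval_mem_normalSpan (R := R) this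
    rwa [Monomial.letters, hab] at h
  | br c p q ihp ihq =>
  intro a ha hb hab hbr har
  cases c with
  | blue =>
    -- With `b = ⟨e₁, ⋯⟨eₖ, r⟩⋯⟩` the bracket `⟨a, b⟩` is a word of left brackets applied to `r`.
    obtain ⟨L, hL, hlet, hev⟩ := exists_blue_word R _ hb (by simp)
    rw [hbr] at hlet hev
    have hword : applyWord (bracket R X .blue) (gen R X r) (a :: L) ∈ normalSpan R s := by
      let _ : DecidableRel fun a b : Monomial X => b.root ≤ a.root := fun a b =>
        inferInstanceAs (Decidable (b.root ≤ a.root))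
      have _ : Std.Total fun a b : Monomial X => b.root ≤ a.root := ⟨fun a b => le_total _ _⟩
      have _ : IsTrans (Monomial X) fun a b => b.root ≤ a.root := ⟨fun a b c h h' => h'.trans h⟩
      refine applyWord_mem (op := bracket R X .blue) (v₀ := gen R X r) (s₀ := {r})
        (β := fun x y => bracket R X .blue x y) (c := .blue) hN
        (fun x y v => bracket_left_comm R .blue x y v) (fun x y => Or.inl rfl)
        (fun x y => Or.inl rfl) (by simp) (eval_mem_normalSpan (m := .var r) trivial) hsN hs
        (fun a => r < a.root) (fun a b => b.root ≤ a.root) ?_ ?_ _ ?_ ?_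
      · exact hbig_span
      · intro L hL hP hsort hsum
        have hnd : (lettersSum L).Nodup :=
          Multiset.nodup_of_le (by rw [← hsum]; exact Multiset.le_add_right _ _) hs
        rw [← hsum] at hs
        obtain ⟨m, hm, -, -, hml, hme⟩ := exists_normal_of_blue_word R r L hL
          (fun e he => by
            refine lt_of_le_of_ne (not_lt.1 (hP e he)) fun heq => ?_
            exact Multiset.disjoint_left.1 (Multiset.nodup_add.1 hs).2.2
              (root_mem_lettersSum he) (by simp [heq]))
          ((hsort.and (pairwise_root_ne hnd)).imp fun h => lt_of_le_of_ne h.1 h.2.symm)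
        rw [hme, ← hsum, hml]
        exact eval_mem_normalSpan hm
      · simpa using ⟨ha, hL⟩
      · rw [← hab, ← hlet, lettersSum_cons]
        abel
    rw [← hev]
    exact hword
  | red =>
    obtain ⟨hp, hq, hpq, -⟩ := hb
    have hpr : p.root = r := hbr
    have hapq : a.letters + (p.letters + q.letters) = s := hab
    have hcard := congrArg Multiset.card hapq
    simp only [Multiset.card_add] at hcard
    have hca := a.card_letters_pos
    have hcp := p.card_letters_pos
    have hcq := q.card_letters_pos
    have hnd : ∀ {t u : Multiset X}, t + u = s → t.Nodup := fun h =>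
      Multiset.nodup_of_le (by rw [← h]; exact Multiset.le_add_right _ _) hs
    have hsub : ∀ (c : Color) {x y z : Monomial X}, x.Normal → y.Normal →
        x.letters + y.letters + z.letters = s →
        bracket R X c (x.eval R) (y.eval R) ∈ normalSpan R (x.letters + y.letters) := by
      intro c x y z hx hy h
      refine hN c x y hx hy (hnd h) ?_
      have h1 := congrArg Multiset.card h
      have hz := z.card_letters_pos
      simp only [Multiset.card_add] at h1 ⊢
      omega
    have hred : ∀ {x y z : Monomial X}, x.Normal → y.Normal → z.Normal →
        y.letters + z.letters + x.letters = s →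
        bracket R X .red (x.eval R) (bracket R X .blue (y.eval R) (z.eval R)) ∈
          normalSpan R s := by
      intro x y z hx hy hz h
      refine map_mem_of_mem_normalSpan _ (bracket R X .red (x.eval R)) (fun m hm hmt => ?_)
        (hsub .blue hy hz h)
      exact hN.red_mem hs hsN x m hx hm (by rw [hmt, add_comm, h])
    -- The mixed Jacobi identity writes `⟨a, [p, q]⟩` as a combination of the five terms `h1` to `h5`:
    -- `h1`, `h2`, `h3` are red brackets, `h4` is blue with the entry `q`, whose root is above `r`, and
    -- `h5` is blue with the entry `p`, which has the root `r` and is smaller than `b`.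
    have h1 := hred ha hp hq (by rw [← hapq]; abel)
    have h2 := hred hp hq ha (by rw [← hapq]; abel)
    have h3 := hred hq ha hp (by rw [← hapq]; abel)
    have h4 : bracket R X .blue (q.eval R) (bracket R X .red (a.eval R) (p.eval R)) ∈
        normalSpan R s :=
      hbig_span q _ _ hq (by rw [← hpr]; exact hpq) (by rw [← hapq]; abel)
        (hsub .red (z := q) ha hp (by rw [← hapq]; abel))
    have h5 : bracket R X .blue (p.eval R) (bracket R X .red (q.eval R) (a.eval R)) ∈
        normalSpan R s := by
      refine map_mem_of_mem_normalSpan _ (bracket R X .blue (p.eval R)) (fun m hm hmt => ?_)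
        (hsub .red (z := p) hq ha (by rw [← hapq]; abel))
      have hmp : m.letters + p.letters = s := by rw [hmt, ← hapq]; abel
      rw [bracket_swap]
      refine neg_mem ?_
      rcases lt_or_gt_of_ne (root_ne_root hs hmp) with h | h
      · exact ihp m hm hp hmp hpr (by rw [← hpr]; exact h)
      · exact hbig m p hm hp hmp (by rw [← hpr]; exact h)
    have hJ := bracket_mixed_jacobi R (a.eval R) (p.eval R) (q.eval R)
    have hsum := add_mem (add_mem (add_mem (add_mem h1 h2) h3) h5) h4
    have hkey : bracket R X .blue (a.eval R) ((Monomial.br .red p q).eval R) =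
        -(bracket R X .red (a.eval R) (bracket R X .blue (p.eval R) (q.eval R)) +
          bracket R X .red (p.eval R) (bracket R X .blue (q.eval R) (a.eval R)) +
          bracket R X .red (q.eval R) (bracket R X .blue (a.eval R) (p.eval R)) +
          bracket R X .blue (p.eval R) (bracket R X .red (q.eval R) (a.eval R)) +
          bracket R X .blue (q.eval R) (bracket R X .red (a.eval R) (p.eval R))) := by
      rw [Monomial.eval, ← sub_eq_zero, ← hJ]
      abel
    rw [hkey]
    exact neg_mem hsum

theorem spansBelow (N : ℕ) : SpansBelow R X N := by
  induction N with
  | zero => intro c a b _ _ _ h; omega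
  | succ N ih =>
    intro c a b ha hb hnd hc
    cases c with
    | red => exact ih.red_mem hnd (by omega) a b ha hb rfl
    | blue => exact ih.blue_mem hnd (by omega) a b ha hb rfl

/-- Every monomial without repeated letters is a combination of normal ones. -/
theorem eval_mem_normalSpan_of_nodup (m : Monomial X) (h : m.letters.Nodup) :
    m.eval R ∈ normalSpan R m.letters := by
  induction m with
  | var x => exact eval_mem_normalSpan trivial
  | br c a b iha ihb =>
    have h' := Multiset.nodup_add.1 h
    exact (spansBelow _).bracket_mem c h (Nat.lt_succ_self _) (iha h'.1) (ihb h'.2.1)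

end Spanning

/-! ### The tree of a monomial -/

section Edges

variable {X : Type*}

/-- The edges of the rooted tree of a monomial, as pairs of a parent and a child: each bracket
joins the roots of its two entries. They are encoded as an exponent vector, so that they can be
compared with the monomials of polynomials. -/
noncomputable def Monomial.edges : Monomial X → (X × X →₀ ℕ)
  | .var _ => 0
  | .br .red a b => a.edges + b.edges + Finsupp.single (a.root, b.root) 1
  | .br .blue a b => a.edges + b.edges + Finsupp.single (b.root, a.root) 1

theorem single_one_ne_zero_iff {α : Type*} {e f : α} :
    Finsupp.single e (1 : ℕ) f ≠ 0 ↔ e = f := by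
  classical
  rw [Finsupp.single_apply]
  split_ifs with h <;> simp [h]

theorem Monomial.edges_red_ne_zero {a b : Monomial X} {e : X × X} :
    (Monomial.br .red a b).edges e ≠ 0 ↔
      a.edges e ≠ 0 ∨ b.edges e ≠ 0 ∨ (a.root, b.root) = e := by
  rw [edges, Finsupp.add_apply, Finsupp.add_apply, ← single_one_ne_zero_iff]
  omega

theorem Monomial.edges_blue_ne_zero {a b : Monomial X} {e : X × X} :
    (Monomial.br .blue a b).edges e ≠ 0 ↔
      a.edges e ≠ 0 ∨ b.edges e ≠ 0 ∨ (b.root, a.root) = e := by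
  rw [edges, Finsupp.add_apply, Finsupp.add_apply, ← single_one_ne_zero_iff]
  omega

theorem Monomial.mem_letters_of_edges {m : Monomial X} {u v : X} (h : m.edges (u, v) ≠ 0) :
    u ∈ m.letters ∧ v ∈ m.letters := by
  induction m with
  | var x => simp [edges] at h
  | br c a b iha ihb =>
    simp only [letters, Multiset.mem_add]
    have ha := a.root_mem_letters
    have hb := b.root_mem_letters
    cases c
    · rcases edges_red_ne_zero.1 h with h | h | h
      · exact ⟨.inl (iha h).1, .inl (iha h).2⟩
      · exact ⟨.inr (ihb h).1, .inr (ihb h).2⟩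
      · cases h
        exact ⟨.inl ha, .inr hb⟩
    · rcases edges_blue_ne_zero.1 h with h | h | h
      · exact ⟨.inl (iha h).1, .inl (iha h).2⟩
      · exact ⟨.inr (ihb h).1, .inr (ihb h).2⟩
      · cases h
        exact ⟨.inr hb, .inl ha⟩

theorem Monomial.nodup_left {c : Color} {a b : Monomial X} (h : (Monomial.br c a b).letters.Nodup) :
    a.letters.Nodup := (Multiset.nodup_add.1 h).1

theorem Monomial.nodup_right {c : Color} {a b : Monomial X}
    (h : (Monomial.br c a b).letters.Nodup) : b.letters.Nodup := (Multiset.nodup_add.1 h).2.1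

theorem Monomial.not_mem_both {c : Color} {a b : Monomial X}
    (h : (Monomial.br c a b).letters.Nodup) {x : X} (ha : x ∈ a.letters) (hb : x ∈ b.letters) :
    False := Multiset.disjoint_left.1 (Multiset.nodup_add.1 h).2.2 ha hb

/-- Two letters are joined by an edge of the tree of `m`, in one direction or the other. -/
def Monomial.Linked (m : Monomial X) (u v : X) : Prop :=
  m.edges (u, v) ≠ 0 ∨ m.edges (v, u) ≠ 0

theorem Monomial.Linked.mem {m : Monomial X} {u v : X} (h : m.Linked u v) :
    u ∈ m.letters ∧ v ∈ m.letters := by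
  rcases h with h | h
  · exact mem_letters_of_edges h
  · exact (mem_letters_of_edges h).symm

theorem Monomial.linked_br {c : Color} {a b : Monomial X} {u v : X} :
    (Monomial.br c a b).Linked u v ↔
      a.Linked u v ∨ b.Linked u v ∨ s(u, v) = s(a.root, b.root) := by
  cases c
  · simp only [Linked, edges_red_ne_zero, Sym2.eq_iff, Prod.mk.injEq]
    grind
  · simp only [Linked, edges_blue_ne_zero, Sym2.eq_iff, Prod.mk.injEq]
    grind

theorem Monomial.Linked.ne {m : Monomial X} (hm : m.letters.Nodup) {u v : X}
    (h : m.Linked u v) : u ≠ v := by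
  induction m with
  | var x => simp [Linked, edges] at h
  | br c a b iha ihb =>
    rcases linked_br.1 h with h | h | h
    · exact iha (nodup_left hm) h
    · exact ihb (nodup_right hm) h
    · rintro rfl
      have h' : u = a.root ∧ u = b.root := by
        rcases Sym2.eq_iff.1 h with h | h
        · exact h
        · exact h.symm
      exact not_mem_both hm (h'.1 ▸ a.root_mem_letters) (h'.2 ▸ b.root_mem_letters)

/-- The graph `G` restricts to the tree of `m` on the letters of `m`, and these form a union of
components of `G`. -/
def Monomial.Agrees (m : Monomial X) (G : SimpleGraph X) : Prop :=
  ∀ u ∈ m.letters, ∀ v, G.Adj u v ↔ m.Linked u v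

theorem Monomial.agrees_br {c : Color} {a b : Monomial X} {G : SimpleGraph X}
    (hnd : (Monomial.br c a b).letters.Nodup) (hadj : G.Adj a.root b.root) :
    (Monomial.br c a b).Agrees G ↔
      a.Agrees (G.deleteEdges {s(a.root, b.root)}) ∧
        b.Agrees (G.deleteEdges {s(a.root, b.root)}) := by
  have hab := fun x => @not_mem_both _ c a b hnd x
  have hra := a.root_mem_letters
  have hrb := b.root_mem_letters
  simp only [Agrees, linked_br, SimpleGraph.deleteEdges_adj, Set.mem_singleton_iff, letters,
    Multiset.mem_add]
  have hA : ∀ {u v}, a.Linked u v → s(u, v) ≠ s(a.root, b.root) := by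
    intro u v h heq
    rcases Sym2.eq_iff.1 heq with ⟨-, rfl⟩ | ⟨rfl, -⟩
    · exact hab _ h.mem.2 hrb
    · exact hab _ h.mem.1 hrb
  have hB : ∀ {u v}, b.Linked u v → s(u, v) ≠ s(a.root, b.root) := by
    intro u v h heq
    rcases Sym2.eq_iff.1 heq with ⟨rfl, -⟩ | ⟨-, rfl⟩
    · exact hab _ hra h.mem.1
    · exact hab _ hra h.mem.2
  constructor
  · refine fun h => ⟨fun u hu v => ?_, fun u hu v => ?_⟩
    · rw [h u (.inl hu) v]
      have h1 : ¬ b.Linked u v := fun h => hab u hu h.mem.1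
      have h2 := @hA u v
      grind
    · rw [h u (.inr hu) v]
      have h1 : ¬ a.Linked u v := fun h => hab u h.mem.1 hu
      have h2 := @hB u v
      grind
  · rintro ⟨h, h'⟩ u hu v
    by_cases heq : s(u, v) = s(a.root, b.root)
    · refine iff_of_true ?_ (.inr (.inr heq))
      rwa [← SimpleGraph.mem_edgeSet, heq]
    · rcases hu with hu | hu
      · have h1 : ¬ b.Linked u v := fun h => hab u hu h.mem.1
        have h2 := h u hu v
        tauto
      · have h1 : ¬ a.Linked u v := fun h => hab u h.mem.1 hu
        have h2 := h' u hu v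
        tauto

/-- The graph with the edges of the tree of `m`. -/
def Monomial.graph (m : Monomial X) : SimpleGraph X :=
  SimpleGraph.fromRel fun u v => m.edges (u, v) ≠ 0

theorem Monomial.graph_adj {m : Monomial X} (hm : m.letters.Nodup) {u v : X} :
    m.graph.Adj u v ↔ m.Linked u v := by
  rw [graph, SimpleGraph.fromRel_adj]
  exact ⟨fun h => h.2, fun h => ⟨Linked.ne hm h, h⟩⟩

theorem Monomial.edges_root (m : Monomial X) (hm : m.letters.Nodup) (u : X) :
    m.edges (u, m.root) = 0 := by
  by_contra h
  induction m with
  | var x => simp [edges] at h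
  | br c a b iha ihb =>
    have hra := a.root_mem_letters
    have hrb := b.root_mem_letters
    have hab := fun x => @not_mem_both _ c a b hm x
    cases c
    · rcases edges_red_ne_zero.1 h with h | h | h
      · exact iha (nodup_left hm) h
      · exact hab _ hra (mem_letters_of_edges h).2
      · have h2 : b.root = a.root := (Prod.ext_iff.1 h).2
        exact hab _ hra (h2 ▸ hrb)
    · rcases edges_blue_ne_zero.1 h with h | h | h
      · exact hab _ (mem_letters_of_edges h).2 hrb
      · exact ihb (nodup_right hm) h
      · have h2 : a.root = b.root := (Prod.ext_iff.1 h).2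
        exact hab _ hra (h2 ▸ hrb)

variable [LinearOrder X]

theorem Monomial.RedBound.lt {m : Monomial X} (hn : m.Normal) (hm : m.letters.Nodup) {b c : X}
    (hb : m.RedBound b) (h : m.edges (m.root, c) ≠ 0) (hc : m.root < c) : b < c := by
  induction m generalizing b with
  | var x => simp [edges] at h
  | br k p q ihp ihq =>
    have hrp := p.root_mem_letters
    have hrq := q.root_mem_letters
    have hpq := fun x => @not_mem_both _ k p q hm x
    cases k
    · rcases edges_red_ne_zero.1 h with h | h | h
      · exact lt_trans hb (ihp hn.1 (nodup_left hm) hn.2.2.2 h hc)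
      · exact (hpq _ hrp (mem_letters_of_edges h).1).elim
      · cases h
        exact hb
    · rcases edges_blue_ne_zero.1 h with h | h | h
      · exact (hpq _ (mem_letters_of_edges h).1 hrq).elim
      · refine ihq hn.2.1 (nodup_right hm) ?_ h hc
        have hq := hn.2.2.2
        cases q with
        | var => trivial
        | br k _ _ =>
          cases k
          · exact hq.elim
          · trivial
      · cases h
        exact (hc.not_gt hn.2.2.1).elim

theorem Monomial.BlueBound.lt {m : Monomial X} (hn : m.Normal) (hm : m.letters.Nodup) {b c : X}
    (hb : m.BlueBound b) (h : m.edges (m.root, c) ≠ 0) : c < b := by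
  induction m generalizing b with
  | var x => simp [edges] at h
  | br k p q ihp ihq =>
    cases k
    · exact hb.elim
    · rcases edges_blue_ne_zero.1 h with h | h | h
      · exact (not_mem_both hm (mem_letters_of_edges h).1 q.root_mem_letters).elim
      · exact lt_trans (ihq hn.2.1 (nodup_right hm) hn.2.2.2 h) hb
      · cases h
        exact hb

end Edges

section Trees

variable {X : Type*} [Fintype X]

theorem mem_nbrs {G : SimpleGraph X} {r c : X} : c ∈ nbrs G r ↔ G.Adj r c := by simp [nbrs]

variable [LinearOrder X]

theorem mem_upNbrs {G : SimpleGraph X} {r c : X} : c ∈ upNbrs G r ↔ G.Adj r c ∧ r < c := by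
  simp [upNbrs]

/-- A normal monomial can be read off from its tree. -/
theorem Monomial.Agrees.componentMonomial_eq {m : Monomial X} (hn : m.Normal)
    (hm : m.letters.Nodup) {G : SimpleGraph X} (hG : m.Agrees G) :
    componentMonomial G m.root = m := by
  induction m generalizing G with
  | var x =>
    have h : ∀ v, ¬ G.Adj x v := fun v h => by
      simpa [Linked, edges] using (hG x (by simp [letters]) v).1 h
    have h1 : ¬ (upNbrs G x).Nonempty := fun ⟨v, hv⟩ => h v (mem_upNbrs.1 hv).1
    have h2 : ¬ (nbrs G x).Nonempty := fun ⟨v, hv⟩ => h v (mem_nbrs.1 hv)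
    rw [root, componentMonomial, dif_neg h1, dif_neg h2]
  | br k a b iha ihb =>
    have hra := a.root_mem_letters
    have hrb := b.root_mem_letters
    have hab := fun x => @not_mem_both _ k a b hm x
    have hadj : G.Adj a.root b.root :=
      (hG _ (Multiset.mem_add.2 (.inl hra)) _).2 (linked_br.2 (.inr (.inr rfl)))
    obtain ⟨hGa, hGb⟩ := (agrees_br hm hadj).1 hG
    cases k
    · have hnbr : ∀ c, G.Adj a.root c → a.edges (a.root, c) ≠ 0 ∨ c = b.root := by
        intro c hc
        rcases linked_br.1 ((hG _ (Multiset.mem_add.2 (.inl hra)) _).1 hc) with h | h | h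
        · rcases h with h | h
          · exact .inl h
          · exact absurd (a.edges_root (nodup_left hm) _) h
        · exact (hab _ hra h.mem.1).elim
        · rcases Sym2.eq_iff.1 h with h | h
          · exact .inr h.2
          · exact (hab _ hra (h.1 ▸ hrb)).elim
      have hmem : b.root ∈ upNbrs G a.root := mem_upNbrs.2 ⟨hadj, hn.2.2.1⟩
      have hmin : (upNbrs G a.root).min' ⟨_, hmem⟩ = b.root := by
        refine le_antisymm (Finset.min'_le _ _ hmem) (Finset.le_min' _ _ _ fun c hc => ?_)
        obtain ⟨hc, hlt⟩ := mem_upNbrs.1 hc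
        rcases hnbr c hc with h | rfl
        · exact (RedBound.lt hn.1 (nodup_left hm) hn.2.2.2 h hlt).le
        · exact le_rfl
      rw [root, componentMonomial, dif_pos ⟨_, hmem⟩, hmin, iha hn.1 (nodup_left hm) hGa,
        ihb hn.2.1 (nodup_right hm) hGb]
    · have hnbr : ∀ c, G.Adj b.root c → b.edges (b.root, c) ≠ 0 ∨ c = a.root := by
        intro c hc
        rcases linked_br.1 ((hG _ (Multiset.mem_add.2 (.inr hrb)) _).1 hc) with h | h | h
        · exact (hab _ h.mem.1 hrb).elim
        · rcases h with h | h
          · exact .inl h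
          · exact absurd (b.edges_root (nodup_right hm) _) h
        · rcases Sym2.eq_iff.1 h with h | h
          · exact (hab _ hra (h.1 ▸ hrb)).elim
          · exact .inr h.2
      have hle : ∀ c, G.Adj b.root c → c ≤ a.root := by
        intro c hc
        rcases hnbr c hc with h | rfl
        · exact (BlueBound.lt hn.2.1 (nodup_right hm) hn.2.2.2 h).le
        · exact le_rfl
      have hup : ¬ (upNbrs G b.root).Nonempty := fun ⟨c, hc⟩ => by
        obtain ⟨hc, hlt⟩ := mem_upNbrs.1 hc
        exact ((hle c hc).trans_lt hn.2.2.1).not_gt hlt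
      have hmem : a.root ∈ nbrs G b.root := mem_nbrs.2 hadj.symm
      have hmax : (nbrs G b.root).max' ⟨_, hmem⟩ = a.root :=
        le_antisymm (Finset.max'_le _ _ _ fun c hc => hle c (mem_nbrs.1 hc))
          (Finset.le_max' _ _ hmem)
      rw [root, componentMonomial, dif_neg hup, dif_pos ⟨_, hmem⟩, hmax, Sym2.eq_swap,
        iha hn.1 (nodup_left hm) hGa, ihb hn.2.1 (nodup_right hm) hGb]

/-- A normal monomial is determined by the edges and the root of its tree. -/
theorem Monomial.eq_of_edges_eq {m m' : Monomial X} (hn : m.Normal) (hm : m.letters.Nodup)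
    (hn' : m'.Normal) (hm' : m'.letters.Nodup) (he : m.edges = m'.edges)
    (hr : m.root = m'.root) : m = m' := by
  rw [← Agrees.componentMonomial_eq hn hm fun _ _ _ => graph_adj hm,
    ← Agrees.componentMonomial_eq hn' hm' fun _ _ _ => graph_adj hm', graph, graph, he, hr]

/-- The monomial of a component of a forest is normal and describes this component. -/
theorem componentMonomial_spec (G : SimpleGraph X) (r : X) (hG : G.IsAcyclic) :
    (componentMonomial G r).Normal ∧ (componentMonomial G r).root = r ∧
      (componentMonomial G r).letters.Nodup ∧ (componentMonomial G r).Agrees G ∧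
      ∀ u ∈ (componentMonomial G r).letters, G.Reachable r u := by
  -- Joining the monomials on the two sides of an edge of the root.
  have join : ∀ (G : SimpleGraph X) (k : Color) (a b : Monomial X), G.IsAcyclic →
      G.Adj a.root b.root →
      a.letters.Nodup → b.letters.Nodup →
      a.Agrees (G.deleteEdges {s(a.root, b.root)}) →
      b.Agrees (G.deleteEdges {s(a.root, b.root)}) →
      (∀ u ∈ a.letters, (G.deleteEdges {s(a.root, b.root)}).Reachable a.root u) →
      (∀ u ∈ b.letters, (G.deleteEdges {s(a.root, b.root)}).Reachable b.root u) →
      (Monomial.br k a b).letters.Nodup ∧ (Monomial.br k a b).Agrees G ∧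
        ∀ u ∈ (Monomial.br k a b).letters, G.Reachable a.root u ∧ G.Reachable b.root u := by
    intro G k a b hG hadj ha hb hGa hGb hra hrb
    have hbridge : ¬ (G.deleteEdges {s(a.root, b.root)}).Reachable a.root b.root :=
      SimpleGraph.isBridge_iff.1 (SimpleGraph.isAcyclic_iff_forall_adj_isBridge.1 hG hadj)
    have hnd : (Monomial.br k a b).letters.Nodup := by
      refine Multiset.nodup_add.2 ⟨ha, hb, Multiset.disjoint_left.2 fun {u} hua hub => ?_⟩
      exact hbridge ((hra u hua).trans (hrb u hub).symm)
    refine ⟨hnd, (Monomial.agrees_br hnd hadj).2 ⟨hGa, hGb⟩, fun u hu => ?_⟩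
    have hle := G.deleteEdges_le {s(a.root, b.root)}
    rcases Multiset.mem_add.1 hu with hu | hu
    · have h := (hra u hu).mono hle
      exact ⟨h, hadj.symm.reachable.trans h⟩
    · have h := (hrb u hu).mono hle
      exact ⟨hadj.reachable.trans h, h⟩
  induction G, r using componentMonomial.induct with
  | case1 G r h ih1 ih2 =>
    rw [componentMonomial, dif_pos h]
    obtain ⟨hadj, hlt⟩ := mem_upNbrs.1 ((upNbrs G r).min'_mem h)
    have hmin : ∀ c, G.Adj r c → r < c → (upNbrs G r).min' h ≤ c := fun c hc hrc =>
      Finset.min'_le _ _ (mem_upNbrs.2 ⟨hc, hrc⟩)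
    generalize (upNbrs G r).min' h = c at *
    have hle := G.deleteEdges_le {s(r, c)}
    obtain ⟨hn, hr, hnd, hag, hre⟩ := ih1 (hG.anti hle)
    obtain ⟨hn', hr', hnd', hag', hre'⟩ := ih2 (hG.anti hle)
    generalize componentMonomial (G.deleteEdges {s(r, c)}) r = a at *
    generalize componentMonomial (G.deleteEdges {s(r, c)}) c = b at *
    subst hr hr'
    obtain ⟨h1, h2, h3⟩ := join G .red a b hG hadj hnd hnd' hag hag' hre hre'
    refine ⟨⟨hn, hn', hlt, ?_⟩, rfl, h1, h2, fun u hu => (h3 u hu).1⟩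
    cases a with
    | var => trivial
    | br k p q =>
      cases k
      · have hpq := (hag _ (Monomial.root_mem_letters _) q.root).2
          (Monomial.linked_br.2 (.inr (.inr rfl)))
        rw [SimpleGraph.deleteEdges_adj] at hpq
        exact lt_of_le_of_ne (hmin _ hpq.1 hn.2.2.1) fun heq => hpq.2 (by rw [← heq]; rfl)
      · trivial
  | case2 G r h h' ih1 ih2 =>
    rw [componentMonomial, dif_neg h, dif_pos h']
    have hadj := mem_nbrs.1 ((nbrs G r).max'_mem h')
    have hmax : ∀ c, G.Adj r c → c ≤ (nbrs G r).max' h' := fun c hc =>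
      Finset.le_max' _ _ (mem_nbrs.2 hc)
    generalize (nbrs G r).max' h' = c at *
    have hlt : ∀ c, G.Adj r c → c < r := fun c hc =>
      lt_of_le_of_ne (not_lt.1 fun hrc => h ⟨c, mem_upNbrs.2 ⟨hc, hrc⟩⟩) hc.ne'
    have hle := G.deleteEdges_le {s(r, c)}
    obtain ⟨hn, hr, hnd, hag, hre⟩ := ih1 (hG.anti hle)
    obtain ⟨hn', hr', hnd', hag', hre'⟩ := ih2 (hG.anti hle)
    generalize componentMonomial (G.deleteEdges {s(r, c)}) c = a at *
    generalize componentMonomial (G.deleteEdges {s(r, c)}) r = b at *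
    subst hr hr'
    rw [Sym2.eq_swap] at hag hag' hre hre'
    obtain ⟨h1, h2, h3⟩ := join G .blue a b hG hadj.symm hnd hnd' hag hag' hre hre'
    refine ⟨⟨hn, hn', hlt _ hadj, ?_⟩, rfl, h1, h2, fun u hu => (h3 u hu).2⟩
    cases b with
    | var => trivial
    | br k p q =>
      cases k
      · have hpq := (hag' _ (Monomial.root_mem_letters _) q.root).2
          (Monomial.linked_br.2 (.inr (.inr rfl)))
        rw [SimpleGraph.deleteEdges_adj] at hpq
        exact (hlt _ hpq.1).not_gt hn'.2.2.1
      · have hpq := (hag' _ (Monomial.root_mem_letters _) p.root).2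
          (Monomial.linked_br.2 (.inr (.inr Sym2.eq_swap)))
        rw [SimpleGraph.deleteEdges_adj] at hpq
        exact lt_of_le_of_ne (hmax _ hpq.1) fun heq => hpq.2 (by rw [← heq]; exact Sym2.eq_swap)
  | case3 G r h h' =>
    rw [componentMonomial, dif_neg h, dif_neg h']
    refine ⟨trivial, rfl, by simp [Monomial.letters], fun u hu v => ?_, fun u hu => ?_⟩
    · obtain rfl : u = r := by simpa [Monomial.letters] using hu
      refine iff_of_false (fun huv => h' ⟨v, mem_nbrs.2 huv⟩) ?_
      simp [Monomial.Linked, Monomial.edges]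
    · obtain rfl : u = r := by simpa [Monomial.letters] using hu
      exact SimpleGraph.Reachable.refl _

end Trees

/-! ### Rooted trees that cross a monomial -/

section Crossing

variable {X : Type*}

theorem Monomial.mem_letters_br {c : Color} {a b : Monomial X} {x : X} :
    x ∈ (Monomial.br c a b).letters ↔ x ∈ a.letters ∨ x ∈ b.letters :=
  Multiset.mem_add

/-- The condition that an edge from the parent `u` to the child `v` has colour `c`. -/
def Color.Rel [LinearOrder X] : Color → X → X → Prop
  | .red, u, v => u < v
  | .blue, u, v => v < u

/-- `Crosses m D w` says that `D` is a tree on the letters of `m`, with root `w`, whose edges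
correspond to the brackets of `m` in such a way that the edge of the bracket `[a, b]_c` has
colour `c` and joins a letter of `a` to a letter of `b`. Then `D` restricts to rooted trees on
the letters of `a` and of `b`, and the edge in question ends in the root of one of them. -/
inductive Crosses [LinearOrder X] : Monomial X → (X × X →₀ ℕ) → X → Prop
  | var (x : X) : Crosses (.var x) 0 x
  | left {c : Color} {a b : Monomial X} {D E : X × X →₀ ℕ} {u w w' : X} (ha : Crosses a D w)
      (hb : Crosses b E w') (hu : u ∈ a.letters) (hc : c.Rel u w') :
      Crosses (.br c a b) (D + E + Finsupp.single (u, w') 1) w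
  | right {c : Color} {a b : Monomial X} {D E : X × X →₀ ℕ} {u w w' : X} (ha : Crosses a D w)
      (hb : Crosses b E w') (hu : u ∈ b.letters) (hc : c.Rel u w) :
      Crosses (.br c a b) (D + E + Finsupp.single (u, w) 1) w'

theorem add_single_ne_zero {D E : X × X →₀ ℕ} {e f : X × X} :
    (D + E + Finsupp.single e 1 : X × X →₀ ℕ) f ≠ 0 ↔ D f ≠ 0 ∨ E f ≠ 0 ∨ e = f := by
  rw [Finsupp.add_apply, Finsupp.add_apply, ← single_one_ne_zero_iff]
  omega

/-- The descendants of `x` in the directed graph with edges `D`. -/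
def descendants (D : X × X →₀ ℕ) (x : X) : Set X :=
  {y | Relation.ReflTransGen (fun u v => D (u, v) ≠ 0) x y}

theorem descendants_mono {D E : X × X →₀ ℕ} (h : ∀ u v, D (u, v) ≠ 0 → E (u, v) ≠ 0) (x : X) :
    descendants D x ⊆ descendants E x :=
  fun _ hy => Relation.ReflTransGen.mono h _ _ hy

theorem descendants_subset_of_mem {D : X × X →₀ ℕ} {x y : X} (h : y ∈ descendants D x) :
    descendants D y ⊆ descendants D x :=
  fun _ hz => Relation.ReflTransGen.trans h hz

theorem mem_descendants_self (D : X × X →₀ ℕ) (x : X) : x ∈ descendants D x :=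
  Relation.ReflTransGen.refl

theorem descendants_subset_of_closed {D : X × X →₀ ℕ} {x : X} {A : Set X} (hx : x ∈ A)
    (h : ∀ u v, D (u, v) ≠ 0 → u ∈ A → v ∈ A) : descendants D x ⊆ A := by
  intro y hy
  induction hy with
  | refl => exact hx
  | tail _ huv ih => exact h _ _ huv ih

open Classical in
/-- The edges of `D` between vertices in `A`. -/
noncomputable def restrict (A : Set X) (D : X × X →₀ ℕ) : X × X →₀ ℕ :=
  D.filter fun e => e.1 ∈ A ∧ e.2 ∈ A

theorem restrict_add (A : Set X) (D E : X × X →₀ ℕ) :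
    restrict A (D + E) = restrict A D + restrict A E := by
  classical exact Finsupp.filter_add

theorem restrict_eq_self {A : Set X} {D : X × X →₀ ℕ}
    (h : ∀ u v, D (u, v) ≠ 0 → u ∈ A ∧ v ∈ A) : restrict A D = D := by
  classical exact Finsupp.filter_eq_self_iff _ _ |>.2 fun e he => h e.1 e.2 he

theorem restrict_eq_zero {A : Set X} {D : X × X →₀ ℕ}
    (h : ∀ u v, D (u, v) ≠ 0 → u ∉ A ∨ v ∉ A) : restrict A D = 0 := by
  classical
  refine (Finsupp.filter_eq_zero_iff _ _).2 fun e he => ?_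
  by_contra hne
  rcases h e.1 e.2 hne with h | h
  · exact h he.1
  · exact h he.2

theorem restrict_single {A : Set X} {u v : X} (hu : u ∈ A) (hv : v ∈ A) :
    restrict A (Finsupp.single (u, v) 1) = Finsupp.single (u, v) 1 :=
  restrict_eq_self fun u' v' h => by
    cases single_one_ne_zero_iff.1 h
    exact ⟨hu, hv⟩

theorem restrict_single_of_not {A : Set X} {u v : X} (h : u ∉ A ∨ v ∉ A) :
    restrict A (Finsupp.single (u, v) 1) = 0 :=
  restrict_eq_zero fun u' v' h' => by
    cases single_one_ne_zero_iff.1 h'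
    exact h

variable [LinearOrder X] {m : Monomial X} {D : X × X →₀ ℕ} {w : X}

theorem Crosses.root_mem (h : Crosses m D w) : w ∈ m.letters := by
  induction h with
  | var x => simp [Monomial.letters]
  | left _ _ _ _ iha _ => exact Monomial.mem_letters_br.2 (.inl iha)
  | right _ _ _ _ _ ihb => exact Monomial.mem_letters_br.2 (.inr ihb)

theorem Crosses.mem_letters (h : Crosses m D w) {u v : X} (huv : D (u, v) ≠ 0) :
    u ∈ m.letters ∧ v ∈ m.letters := by
  induction h with
  | var x => simp at huv
  | left ha hb hu _ iha ihb =>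
    simp only [Monomial.mem_letters_br]
    have := hb.root_mem
    rcases add_single_ne_zero.1 huv with h | h | h
    · exact ⟨.inl (iha h).1, .inl (iha h).2⟩
    · exact ⟨.inr (ihb h).1, .inr (ihb h).2⟩
    · cases h
      exact ⟨.inl hu, .inr this⟩
  | right ha hb hu _ iha ihb =>
    simp only [Monomial.mem_letters_br]
    have := ha.root_mem
    rcases add_single_ne_zero.1 huv with h | h | h
    · exact ⟨.inl (iha h).1, .inl (iha h).2⟩
    · exact ⟨.inr (ihb h).1, .inr (ihb h).2⟩
    · cases h
      exact ⟨.inr hu, .inl this⟩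

theorem Crosses.exists_parent (h : Crosses m D w) {v : X} (hv : v ∈ m.letters) (hvw : v ≠ w) :
    ∃ u, D (u, v) ≠ 0 := by
  induction h with
  | var x => exact absurd (by simpa [Monomial.letters] using hv) hvw
  | @left c a b D E u w w' ha hb hu hc iha ihb =>
    simp only [add_single_ne_zero]
    rcases Monomial.mem_letters_br.1 hv with h | h
    · obtain ⟨x, hx⟩ := iha h hvw
      exact ⟨x, .inl hx⟩
    · by_cases h' : v = w'
      · exact ⟨u, .inr (.inr (by rw [h']))⟩
      · obtain ⟨x, hx⟩ := ihb h h'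
        exact ⟨x, .inr (.inl hx)⟩
  | @right c a b D E u w w' ha hb hu hc iha ihb =>
    simp only [add_single_ne_zero]
    rcases Monomial.mem_letters_br.1 hv with h | h
    · by_cases h' : v = w
      · exact ⟨u, .inr (.inr (by rw [h']))⟩
      · obtain ⟨x, hx⟩ := iha h h'
        exact ⟨x, .inl hx⟩
    · obtain ⟨x, hx⟩ := ihb h hvw
      exact ⟨x, .inr (.inl hx)⟩

theorem Crosses.subset_descendants (h : Crosses m D w) {y : X} (hy : y ∈ m.letters) :
    y ∈ descendants D w := by
  induction h generalizing y with
  | var x =>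
    obtain rfl : y = x := by simpa [Monomial.letters] using hy
    exact mem_descendants_self _ _
  | @left c a b D E u w w' ha hb hu hc iha ihb =>
    have hD : ∀ x, descendants D x ⊆ descendants (D + E + Finsupp.single (u, w') 1) x :=
      descendants_mono fun _ _ h => add_single_ne_zero.2 (.inl h)
    have hE : ∀ x, descendants E x ⊆ descendants (D + E + Finsupp.single (u, w') 1) x :=
      descendants_mono fun _ _ h => add_single_ne_zero.2 (.inr (.inl h))
    rcases Monomial.mem_letters_br.1 hy with h | h
    · exact hD _ (iha h)
    · refine descendants_subset_of_mem ?_ (hE _ (ihb h))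
      exact Relation.ReflTransGen.tail (hD _ (iha hu)) (add_single_ne_zero.2 (.inr (.inr rfl)))
  | @right c a b D E u w w' ha hb hu hc iha ihb =>
    have hD : ∀ x, descendants D x ⊆ descendants (D + E + Finsupp.single (u, w) 1) x :=
      descendants_mono fun _ _ h => add_single_ne_zero.2 (.inl h)
    have hE : ∀ x, descendants E x ⊆ descendants (D + E + Finsupp.single (u, w) 1) x :=
      descendants_mono fun _ _ h => add_single_ne_zero.2 (.inr (.inl h))
    rcases Monomial.mem_letters_br.1 hy with h | h
    · refine descendants_subset_of_mem ?_ (hD _ (iha h))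
      exact Relation.ReflTransGen.tail (hE _ (ihb hu)) (add_single_ne_zero.2 (.inr (.inr rfl)))
    · exact hE _ (ihb h)

/-- A normal monomial is crossed by its own tree. -/
theorem Monomial.Normal.crosses_edges (h : m.Normal) : Crosses m m.edges m.root := by
  induction m with
  | var x => exact .var x
  | br c a b iha ihb =>
    cases c
    · exact .left (iha h.1) (ihb h.2.1) a.root_mem_letters h.2.2.1
    · exact .right (iha h.1) (ihb h.2.1) b.root_mem_letters h.2.2.1

/-- If the root of a normal monomial is its largest or its smallest letter, then every tree that
crosses the monomial has the same root. -/
theorem Crosses.root_eq (h : Crosses m D w) (hn : m.Normal)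
    (hext : (∀ y ∈ m.letters, y ≤ m.root) ∨ ∀ y ∈ m.letters, m.root ≤ y) : w = m.root := by
  induction h with
  | var x => rfl
  | @left c a b D E u w w' ha hb hu hc iha ihb =>
    cases c
    · rcases hext with h | h
      · exact ((h _ (Monomial.mem_letters_br.2 (.inr b.root_mem_letters))).not_gt hn.2.2.1).elim
      · exact iha hn.1 (.inr fun y hy => h y (Monomial.mem_letters_br.2 (.inl hy)))
    · rcases hext with h | h
      · have := ihb hn.2.1 (.inl fun y hy => h y (Monomial.mem_letters_br.2 (.inr hy)))
        subst this
        exact ((h _ (Monomial.mem_letters_br.2 (.inl hu))).not_gt hc).elim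
      · exact ((h _ (Monomial.mem_letters_br.2 (.inl a.root_mem_letters))).not_gt hn.2.2.1).elim
  | @right c a b D E u w w' ha hb hu hc iha ihb =>
    cases c
    · rcases hext with h | h
      · exact ((h _ (Monomial.mem_letters_br.2 (.inr b.root_mem_letters))).not_gt hn.2.2.1).elim
      · have := iha hn.1 (.inr fun y hy => h y (Monomial.mem_letters_br.2 (.inl hy)))
        subst this
        exact ((h _ (Monomial.mem_letters_br.2 (.inr hu))).not_gt hc).elim
    · rcases hext with h | h
      · exact ihb hn.2.1 (.inl fun y hy => h y (Monomial.mem_letters_br.2 (.inr hy)))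
      · exact ((h _ (Monomial.mem_letters_br.2 (.inl a.root_mem_letters))).not_gt hn.2.2.1).elim

end Crossing

/-! ### Cutting off the branch of a vertex -/

section Grafting

variable {X : Type*}

/-- `Grafting m s d p` says that `m` arises from `d` by attaching `s` to the vertex `p`: in terms
of trees, `s` is the branch of `m` at the vertex `s.root`, whose parent is `p`, and `d` is the rest
of `m`. -/
inductive Grafting : Monomial X → Monomial X → Monomial X → X → Prop
  | red (a b : Monomial X) : Grafting (.br .red a b) b a a.root
  | blue (a b : Monomial X) : Grafting (.br .blue a b) a b b.root
  | left {a s d : Monomial X} {p : X} (c : Color) (b : Monomial X) (h : Grafting a s d p) :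
      Grafting (.br c a b) s (.br c d b) p
  | right {b s d : Monomial X} {p : X} (c : Color) (a : Monomial X) (h : Grafting b s d p) :
      Grafting (.br c a b) s (.br c a d) p

variable {m s d : Monomial X} {p : X}

theorem exists_grafting (m : Monomial X) {x : X} (hx : x ∈ m.letters) (hxm : x ≠ m.root) :
    ∃ s d p, Grafting m s d p ∧ s.root = x := by
  induction m with
  | var y => exact absurd (by simpa [Monomial.letters, Monomial.root] using hx) hxm
  | br c a b iha ihb =>
    rcases Monomial.mem_letters_br.1 hx with h | h
    · by_cases hxa : x = a.root
      · cases c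
        · exact absurd hxa hxm
        · exact ⟨_, _, _, .blue a b, hxa.symm⟩
      · obtain ⟨s, d, p, h, hs⟩ := iha h hxa
        exact ⟨_, _, _, .left c b h, hs⟩
    · by_cases hxb : x = b.root
      · cases c
        · exact ⟨_, _, _, .red a b, hxb.symm⟩
        · exact absurd hxb hxm
      · obtain ⟨s, d, p, h, hs⟩ := ihb h hxb
        exact ⟨_, _, _, .right c a h, hs⟩

theorem Grafting.letters_eq (h : Grafting m s d p) : m.letters = s.letters + d.letters := by
  induction h with
  | red a b => exact add_comm _ _
  | blue a b => rfl
  | left c b _ ih => simp only [Monomial.letters, ih, add_assoc]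
  | right c a _ ih =>
    simp only [Monomial.letters, ih]
    abel

theorem Grafting.root_eq (h : Grafting m s d p) : d.root = m.root := by
  induction h with
  | red a b => rfl
  | blue a b => rfl
  | left c b _ ih => cases c <;> simp [Monomial.root, ih]
  | right c a _ ih => cases c <;> simp [Monomial.root, ih]

theorem Grafting.mem_letters (h : Grafting m s d p) : p ∈ d.letters := by
  induction h with
  | red a b => exact a.root_mem_letters
  | blue a b => exact b.root_mem_letters
  | left c b _ ih => exact Monomial.mem_letters_br.2 (.inl ih)
  | right c a _ ih => exact Monomial.mem_letters_br.2 (.inr ih)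

theorem Grafting.edges_eq (h : Grafting m s d p) :
    m.edges = s.edges + d.edges + Finsupp.single (p, s.root) 1 := by
  induction h with
  | red a b => rw [Monomial.edges, add_comm a.edges]
  | blue a b => rfl
  | left c b h ih =>
    cases c <;> simp only [Monomial.edges, ih, h.root_eq] <;> abel
  | right c a h ih =>
    cases c <;> simp only [Monomial.edges, ih, h.root_eq] <;> abel

theorem Grafting.nodup_left (h : Grafting m s d p) (hm : m.letters.Nodup) : s.letters.Nodup :=
  (Multiset.nodup_add.1 (h.letters_eq ▸ hm)).1

theorem Grafting.nodup_right (h : Grafting m s d p) (hm : m.letters.Nodup) : d.letters.Nodup :=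
  (Multiset.nodup_add.1 (h.letters_eq ▸ hm)).2.1

theorem Grafting.not_mem (h : Grafting m s d p) (hm : m.letters.Nodup) {x : X}
    (hs : x ∈ s.letters) (hd : x ∈ d.letters) : False :=
  Multiset.disjoint_left.1 (Multiset.nodup_add.1 (h.letters_eq ▸ hm)).2.2 hs hd

theorem Grafting.descendants_subset (h : Grafting m s d p) (hm : m.letters.Nodup) :
    descendants m.edges s.root ⊆ {y | y ∈ s.letters} := by
  refine descendants_subset_of_closed s.root_mem_letters fun u v huv hu => ?_
  rw [h.edges_eq, add_single_ne_zero] at huv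
  rcases huv with huv | huv | huv
  · exact (Monomial.mem_letters_of_edges huv).2
  · exact (h.not_mem hm hu (Monomial.mem_letters_of_edges huv).1).elim
  · cases huv
    exact s.root_mem_letters

variable [LinearOrder X]

theorem Grafting.normal (h : Grafting m s d p) (hm : m.Normal) :
    s.Normal ∧ d.Normal ∧ (∀ c, m.RedBound c → d.RedBound c) ∧
      (∀ c, m.BlueBound c → d.BlueBound c) := by
  induction h with
  | red a b =>
    refine ⟨hm.2.1, hm.1, fun c hc => ?_, fun c hc => hc.elim⟩
    have h := hm.2.2.2
    cases a with
    | var => trivial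
    | br k _ _ =>
      cases k
      · exact lt_trans hc h
      · trivial
  | blue a b =>
    have h := hm.2.2.2
    refine ⟨hm.1, hm.2.1, fun c hc => ?_, fun c hc => ?_⟩
    · cases b with
      | var => trivial
      | br k _ _ =>
        cases k
        · exact h.elim
        · trivial
    · cases b with
      | var => trivial
      | br k _ _ =>
        cases k
        · exact h.elim
        · exact lt_trans h hc
  | left c b h ih =>
    cases c
    · obtain ⟨h1, h2, h3, h4⟩ := ih hm.1
      exact ⟨h1, ⟨h2, hm.2.1, by rw [h.root_eq]; exact hm.2.2.1, h3 _ hm.2.2.2⟩,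
        fun _ hc => hc, fun _ hc => hc⟩
    · obtain ⟨h1, h2, h3, h4⟩ := ih hm.1
      refine ⟨h1, ⟨h2, hm.2.1, by rw [h.root_eq]; exact hm.2.2.1, by
        rw [h.root_eq]; exact hm.2.2.2⟩, fun _ hc => hc, fun c hc => ?_⟩
      change _ < c
      rw [h.root_eq]
      exact hc
  | right c a h ih =>
    cases c
    · obtain ⟨h1, h2, h3, h4⟩ := ih hm.2.1
      refine ⟨h1, ⟨hm.1, h2, by rw [h.root_eq]; exact hm.2.2.1, by
        rw [h.root_eq]; exact hm.2.2.2⟩, fun c hc => ?_, fun _ hc => hc⟩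
      change c < _
      rw [h.root_eq]
      exact hc
    · obtain ⟨h1, h2, h3, h4⟩ := ih hm.2.1
      exact ⟨h1, ⟨hm.1, h2, by rw [h.root_eq]; exact hm.2.2.1, h4 _ hm.2.2.2⟩,
        fun _ hc => hc, fun _ hc => hc⟩

/-- A tree that crosses a monomial restricts to trees that cross its branches. -/
theorem Grafting.exists_crosses (h : Grafting m s d p) {D : X × X →₀ ℕ} {w : X}
    (hD : Crosses m D w) :
    ∃ E w', Crosses s E w' ∧ ∀ u v, E (u, v) ≠ 0 → D (u, v) ≠ 0 := by
  induction h generalizing D w with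
  | red a b =>
    cases hD with
    | left ha hb hu hc => exact ⟨_, _, hb, fun u v h => add_single_ne_zero.2 (.inr (.inl h))⟩
    | right ha hb hu hc => exact ⟨_, _, hb, fun u v h => add_single_ne_zero.2 (.inr (.inl h))⟩
  | blue a b =>
    cases hD with
    | left ha hb hu hc => exact ⟨_, _, ha, fun u v h => add_single_ne_zero.2 (.inl h)⟩
    | right ha hb hu hc => exact ⟨_, _, ha, fun u v h => add_single_ne_zero.2 (.inl h)⟩
  | left c b h ih =>
    cases hD with
    | left ha hb hu hc =>
      obtain ⟨E, w', hE, hle⟩ := ih ha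
      exact ⟨E, w', hE, fun u v h => add_single_ne_zero.2 (.inl (hle u v h))⟩
    | right ha hb hu hc =>
      obtain ⟨E, w', hE, hle⟩ := ih ha
      exact ⟨E, w', hE, fun u v h => add_single_ne_zero.2 (.inl (hle u v h))⟩
  | right c b h ih =>
    cases hD with
    | left ha hb hu hc =>
      obtain ⟨E, w', hE, hle⟩ := ih hb
      exact ⟨E, w', hE, fun u v h => add_single_ne_zero.2 (.inr (.inl (hle u v h)))⟩
    | right ha hb hu hc =>
      obtain ⟨E, w', hE, hle⟩ := ih hb
      exact ⟨E, w', hE, fun u v h => add_single_ne_zero.2 (.inr (.inl (hle u v h)))⟩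

/-- The branch of a monomial at its largest or smallest letter `s.root` is contained in the
branch at this letter of any tree that crosses the monomial. -/
theorem Grafting.subset_descendants (h : Grafting m s d p) (hn : m.Normal) {D : X × X →₀ ℕ}
    {w : X} (hD : Crosses m D w)
    (hext : (∀ y ∈ m.letters, y ≤ s.root) ∨ ∀ y ∈ m.letters, s.root ≤ y) :
    {y | y ∈ s.letters} ⊆ descendants D s.root := by
  obtain ⟨E, w', hE, hle⟩ := h.exists_crosses hD
  have hsub : ∀ y ∈ s.letters, y ∈ m.letters := fun y hy => by
    rw [h.letters_eq]
    exact Multiset.mem_add.2 (.inl hy)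
  have hw : w' = s.root := hE.root_eq (h.normal hn).1
    (hext.imp (fun h y hy => h y (hsub y hy)) fun h y hy => h y (hsub y hy))
  subst hw
  exact fun y hy => descendants_mono hle _ (hE.subset_descendants hy)

theorem Monomial.Normal.subset_descendants (h : m.Normal) {y : X} (hy : y ∈ m.letters) :
    y ∈ descendants m.edges m.root :=
  h.crosses_edges.subset_descendants hy

/-- If a set `A` of vertices is closed under taking children and misses a letter, it misses the
root. -/
theorem Crosses.root_not_mem {D : X × X →₀ ℕ} {w : X} (hD : Crosses m D w) {A : Set X}
    (hclosed : ∀ u v, D (u, v) ≠ 0 → u ∈ A → v ∈ A) {y : X} (hy : y ∈ m.letters) (hyA : y ∉ A) :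
    w ∉ A := fun hw =>
  hyA (descendants_subset_of_closed hw hclosed (hD.subset_descendants hy))

/-- Suppose that the letters of the branch `s` of the monomial `m` also form the branch at `s.root`
of a tree `D` that crosses `m`. Then the two parts of `D` cross `s` and the rest `d` of `m`, and
the parent `q` of `s.root` in `D` is a descendant, in the tree of `d`, of the parent `p` of `s.root`
in the tree of `m`. -/
theorem Grafting.crosses_restrict (h : Grafting m s d p) (hn : m.Normal) (hm : m.letters.Nodup)
    {D : X × X →₀ ℕ} {w q : X} (hD : Crosses m D w)
    (hclosed : ∀ u v, D (u, v) ≠ 0 → u ∈ s.letters → v ∈ s.letters)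
    (henter : ∀ u v, D (u, v) ≠ 0 → v ∈ s.letters → u ∉ s.letters → u = q ∧ v = s.root) :
    Crosses s (restrict {x | x ∈ s.letters} D) s.root ∧
      Crosses d (restrict {x | x ∈ s.letters}ᶜ D) w ∧ q ∈ descendants d.edges p := by
  have hds : ∀ x ∈ d.letters, x ∉ s.letters := fun x hd hs => h.not_mem hm hs hd
  have hwS : w ∉ s.letters := by
    have hp : p ∈ m.letters := by
      rw [h.letters_eq]
      exact Multiset.mem_add.2 (.inr h.mem_letters)
    exact hD.root_not_mem (A := {x | x ∈ s.letters}) hclosed hp (hds p h.mem_letters)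
  induction h generalizing D w with
  | red a b =>
    cases hD with
    | @left _ _ _ D E u _ w' ha hb hu hc =>
      obtain ⟨rfl, rfl⟩ := henter u w' (add_single_ne_zero.2 (.inr (.inr rfl))) hb.root_mem
        (hds u hu)
      rw [restrict_add, restrict_add, restrict_add, restrict_add,
        restrict_eq_zero (A := {x | x ∈ b.letters}) (D := D)
          fun u v h => .inl (hds u (ha.mem_letters h).1),
        restrict_eq_self (A := {x | x ∈ b.letters}) (D := E) fun u v h => hb.mem_letters h,
        restrict_single_of_not (A := {x | x ∈ b.letters}) (.inl (hds _ hu)),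
        restrict_eq_self (A := {x | x ∈ b.letters}ᶜ) (D := D)
          fun u v h => ⟨hds u (ha.mem_letters h).1, hds v (ha.mem_letters h).2⟩,
        restrict_eq_zero (A := {x | x ∈ b.letters}ᶜ) (D := E)
          fun u v h => .inl (not_not.2 (hb.mem_letters h).1),
        restrict_single_of_not (A := {x | x ∈ b.letters}ᶜ) (.inr (not_not.2 hb.root_mem))]
      simp only [add_zero, zero_add]
      exact ⟨hb, ha, hn.1.subset_descendants hu⟩
    | right ha hb hu hc => exact (hwS hb.root_mem).elim
  | blue a b =>
    cases hD with
    | left ha hb hu hc => exact (hwS ha.root_mem).elim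
    | @right _ _ _ D E u w' _ ha hb hu hc =>
      obtain ⟨rfl, rfl⟩ := henter u w' (add_single_ne_zero.2 (.inr (.inr rfl))) ha.root_mem
        (hds u hu)
      rw [restrict_add, restrict_add, restrict_add, restrict_add,
        restrict_eq_zero (A := {x | x ∈ a.letters}) (D := E)
          fun u v h => .inl (hds u (hb.mem_letters h).1),
        restrict_eq_self (A := {x | x ∈ a.letters}) (D := D) fun u v h => ha.mem_letters h,
        restrict_single_of_not (A := {x | x ∈ a.letters}) (.inl (hds _ hu)),
        restrict_eq_self (A := {x | x ∈ a.letters}ᶜ) (D := E)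
          fun u v h => ⟨hds u (hb.mem_letters h).1, hds v (hb.mem_letters h).2⟩,
        restrict_eq_zero (A := {x | x ∈ a.letters}ᶜ) (D := D)
          fun u v h => .inl (not_not.2 (ha.mem_letters h).1),
        restrict_single_of_not (A := {x | x ∈ a.letters}ᶜ) (.inr (not_not.2 ha.root_mem))]
      simp only [add_zero, zero_add]
      exact ⟨ha, hb, hn.2.1.subset_descendants hu⟩
  | @left a s d p c b h ih =>
    have hna : a.Normal := by cases c <;> exact hn.1
    have hbS : ∀ x ∈ b.letters, x ∉ s.letters := fun x hx =>
      hds x (Monomial.mem_letters_br.2 (.inr hx))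
    have hpa : p ∈ a.letters := by
      rw [h.letters_eq]
      exact Multiset.mem_add.2 (.inr h.mem_letters)
    have hmono : descendants d.edges p ⊆ descendants (Monomial.br c d b).edges p := by
      refine descendants_mono (fun u v huv => ?_) p
      cases c
      · exact Monomial.edges_red_ne_zero.2 (.inl huv)
      · exact Monomial.edges_blue_ne_zero.2 (.inl huv)
    have hd : ∀ x ∈ a.letters, x ∉ s.letters → x ∈ d.letters := fun x hx hxs => by
      rw [h.letters_eq] at hx
      exact (Multiset.mem_add.1 hx).resolve_left hxs
    have hds' := fun x hx => hds x (Monomial.mem_letters_br.2 (.inl hx))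
    cases hD with
    | @left _ _ _ D E u _ w' ha hb hu hc =>
      have huS : u ∉ s.letters := fun h => hbS _ hb.root_mem
        (hclosed u w' (add_single_ne_zero.2 (.inr (.inr rfl))) h)
      obtain ⟨h1, h2, h3⟩ := ih hna (Monomial.nodup_left hm) ha
        (fun u v h => hclosed u v (add_single_ne_zero.2 (.inl h)))
        (fun u v h => henter u v (add_single_ne_zero.2 (.inl h))) hds' hwS
      refine ⟨?_, ?_, hmono h3⟩
      · rw [restrict_add, restrict_add, restrict_eq_zero (A := {x | x ∈ s.letters}) (D := E)
          fun u v h => .inl (hbS u (hb.mem_letters h).1),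
          restrict_single_of_not (A := {x | x ∈ s.letters}) (.inl huS),
          add_zero, add_zero]
        exact h1
      · rw [restrict_add, restrict_add, restrict_eq_self (A := {x | x ∈ s.letters}ᶜ) (D := E)
          fun u v h => ⟨hbS u (hb.mem_letters h).1, hbS v (hb.mem_letters h).2⟩,
          restrict_single (A := {x | x ∈ s.letters}ᶜ) huS (hbS _ hb.root_mem)]
        exact .left h2 hb (hd u hu huS) hc
    | @right _ _ _ D E u w' _ ha hb hu hc =>
      have hclosed' := fun u v h => hclosed u v (add_single_ne_zero.2 (.inl h))
      have hwS' : w' ∉ s.letters :=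
        ha.root_not_mem (A := {x | x ∈ s.letters}) hclosed' hpa (hds' p h.mem_letters)
      obtain ⟨h1, h2, h3⟩ := ih hna (Monomial.nodup_left hm) ha hclosed'
        (fun u v h => henter u v (add_single_ne_zero.2 (.inl h))) hds' hwS'
      refine ⟨?_, ?_, hmono h3⟩
      · rw [restrict_add, restrict_add, restrict_eq_zero (A := {x | x ∈ s.letters}) (D := E)
          fun u v h => .inl (hbS u (hb.mem_letters h).1),
          restrict_single_of_not (A := {x | x ∈ s.letters}) (.inl (hbS u hu)), add_zero, add_zero]
        exact h1
      · rw [restrict_add, restrict_add, restrict_eq_self (A := {x | x ∈ s.letters}ᶜ) (D := E)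
          fun u v h => ⟨hbS u (hb.mem_letters h).1, hbS v (hb.mem_letters h).2⟩,
          restrict_single (A := {x | x ∈ s.letters}ᶜ) (hbS u hu) hwS']
        exact .right h2 hb hu hc
  | @right b s d p c a h ih =>
    have hnb : b.Normal := by cases c <;> exact hn.2.1
    have haS : ∀ x ∈ a.letters, x ∉ s.letters := fun x hx =>
      hds x (Monomial.mem_letters_br.2 (.inl hx))
    have hpb : p ∈ b.letters := by
      rw [h.letters_eq]
      exact Multiset.mem_add.2 (.inr h.mem_letters)
    have hmono : descendants d.edges p ⊆ descendants (Monomial.br c a d).edges p := by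
      refine descendants_mono (fun u v huv => ?_) p
      cases c
      · exact Monomial.edges_red_ne_zero.2 (.inr (.inl huv))
      · exact Monomial.edges_blue_ne_zero.2 (.inr (.inl huv))
    have hd : ∀ x ∈ b.letters, x ∉ s.letters → x ∈ d.letters := fun x hx hxs => by
      rw [h.letters_eq] at hx
      exact (Multiset.mem_add.1 hx).resolve_left hxs
    have hds' := fun x hx => hds x (Monomial.mem_letters_br.2 (.inr hx))
    cases hD with
    | @left _ _ _ D E u _ w' ha hb hu hc =>
      have hclosed' := fun u v h => hclosed u v (add_single_ne_zero.2 (.inr (.inl h)))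
      have hwS' : w' ∉ s.letters :=
        hb.root_not_mem (A := {x | x ∈ s.letters}) hclosed' hpb (hds' p h.mem_letters)
      obtain ⟨h1, h2, h3⟩ := ih hnb (Monomial.nodup_right hm) hb hclosed'
        (fun u v h => henter u v (add_single_ne_zero.2 (.inr (.inl h)))) hds' hwS'
      refine ⟨?_, ?_, hmono h3⟩
      · rw [restrict_add, restrict_add, restrict_eq_zero (A := {x | x ∈ s.letters}) (D := D)
          fun u v h => .inl (haS u (ha.mem_letters h).1),
          restrict_single_of_not (A := {x | x ∈ s.letters}) (.inl (haS u hu)), add_zero, zero_add]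
        exact h1
      · rw [restrict_add, restrict_add, restrict_eq_self (A := {x | x ∈ s.letters}ᶜ) (D := D)
          fun u v h => ⟨haS u (ha.mem_letters h).1, haS v (ha.mem_letters h).2⟩,
          restrict_single (A := {x | x ∈ s.letters}ᶜ) (haS u hu) hwS']
        exact .left ha h2 hu hc
    | @right _ _ _ D E u w' _ ha hb hu hc =>
      have huS : u ∉ s.letters := fun h => haS _ ha.root_mem
        (hclosed u w' (add_single_ne_zero.2 (.inr (.inr rfl))) h)
      obtain ⟨h1, h2, h3⟩ := ih hnb (Monomial.nodup_right hm) hb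
        (fun u v h => hclosed u v (add_single_ne_zero.2 (.inr (.inl h))))
        (fun u v h => henter u v (add_single_ne_zero.2 (.inr (.inl h)))) hds' hwS
      refine ⟨?_, ?_, hmono h3⟩
      · rw [restrict_add, restrict_add, restrict_eq_zero (A := {x | x ∈ s.letters}) (D := D)
          fun u v h => .inl (haS u (ha.mem_letters h).1),
          restrict_single_of_not (A := {x | x ∈ s.letters}) (.inl huS),
          add_zero, zero_add]
        exact h1
      · rw [restrict_add, restrict_add, restrict_eq_self (A := {x | x ∈ s.letters}ᶜ) (D := D)
          fun u v h => ⟨haS u (ha.mem_letters h).1, haS v (ha.mem_letters h).2⟩,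
          restrict_single (A := {x | x ∈ s.letters}ᶜ) huS (haS _ ha.root_mem)]
        exact .right ha h2 (hd u hu huS) hc

end Grafting

/-! ### The crossing relation has no cycles -/

section Acyclic

/-- An antitone sequence of natural numbers is eventually constant. -/
theorem exists_forall_ge_eq_of_antitone (f : ℕ → ℕ) (hf : ∀ k, f (k + 1) ≤ f k) :
    ∃ K, ∀ k ≥ K, f k = f K := by
  obtain ⟨K, hK⟩ := exists_minimal_of_wellFoundedLT (fun n => ∃ k, f k = n) ⟨_, 0, rfl⟩
  obtain ⟨⟨K, rfl⟩, hmin⟩ := hK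
  exact ⟨K, fun k hk => le_antisymm (antitone_nat_of_succ_le hf hk)
    (hmin ⟨k, rfl⟩ (antitone_nat_of_succ_le hf hk))⟩

variable {X : Type*}

open Classical in
/-- The edges of the tree of a monomial increase a height function. -/
theorem Monomial.exists_height (m : Monomial X) (hm : m.letters.Nodup) :
    ∃ h : X → ℕ, ∀ u v, m.edges (u, v) ≠ 0 → h u < h v := by
  induction m with
  | var x => exact ⟨fun _ => 0, fun u v h => by simp [edges] at h⟩
  | br c a b iha ihb =>
    obtain ⟨f, hf⟩ := iha (nodup_left hm)
    obtain ⟨g, hg⟩ := ihb (nodup_right hm)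
    have hra := a.root_mem_letters
    have hrb := b.root_mem_letters
    have hab := fun x => @not_mem_both _ c a b hm x
    cases c
    · refine ⟨fun x => if x ∈ a.letters then f x else f a.root + 1 + g x, fun u v h => ?_⟩
      rcases edges_red_ne_zero.1 h with h | h | h
      · have := mem_letters_of_edges h
        simpa [this] using hf u v h
      · have := mem_letters_of_edges h
        simpa only [if_neg fun h => hab u h this.1, if_neg fun h => hab v h this.2,
          add_lt_add_iff_left] using hg u v h
      · cases h
        simp only [hra, if_true, if_neg fun h => hab _ h hrb]
        omega
    · refine ⟨fun x => if x ∈ b.letters then g x else g b.root + 1 + f x, fun u v h => ?_⟩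
      rcases edges_blue_ne_zero.1 h with h | h | h
      · have := mem_letters_of_edges h
        simpa only [if_neg (hab u this.1), if_neg (hab v this.2), add_lt_add_iff_left] using
          hf u v h
      · have := mem_letters_of_edges h
        simpa [this] using hg u v h
      · cases h
        simp only [hrb, if_true, if_neg fun h => hab _ hra h]
        omega

theorem Monomial.descendants_antisymm {m : Monomial X} (hm : m.letters.Nodup) {x y : X}
    (hxy : y ∈ descendants m.edges x) (hyx : x ∈ descendants m.edges y) : x = y := by
  obtain ⟨h, hh⟩ := m.exists_height hm
  have key : ∀ {u v}, v ∈ descendants m.edges u → u = v ∨ h u < h v := by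
    intro u v huv
    induction huv with
    | refl => exact .inl rfl
    | tail _ hbc ih =>
      have := hh _ _ hbc
      rcases ih with rfl | ih
      · exact .inr this
      · exact .inr (ih.trans this)
  rcases key hxy with h1 | h1
  · exact h1
  · rcases key hyx with h2 | h2
    · exact h2.symm
    · omega

/-- A letter whose branch in the tree of `m` contains all letters is the root. -/
theorem Monomial.root_eq_of_forall_mem_descendants {m : Monomial X} (hm : m.letters.Nodup) {x : X}
    (h : ∀ y ∈ m.letters, y ∈ descendants m.edges x) : m.root = x := by
  by_contra hne
  rcases (h _ m.root_mem_letters).cases_tail with h' | ⟨y, -, hy⟩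
  · exact hne h'
  · exact hy (m.edges_root hm y)

variable [LinearOrder X]

/-- A sequence of normal monomials with letters `t` each of which is crossed by the tree of its
predecessor. -/
structure IsCrossingSeq (t : Multiset X) (m : ℕ → Monomial X) : Prop where
  normal : ∀ k, (m k).Normal
  letters : ∀ k, (m k).letters = t
  crosses : ∀ k, ∃ w, Crosses (m (k + 1)) (m k).edges w

theorem IsCrossingSeq.shift {t : Multiset X} {m : ℕ → Monomial X} (h : IsCrossingSeq t m) (K : ℕ) :
    IsCrossingSeq t fun k => m (K + k) :=
  ⟨fun _ => h.normal _, fun _ => h.letters _, fun k => h.crosses (K + k)⟩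

/-- One step of a crossing sequence, when the branches at a vertex have the same letters. -/
theorem Grafting.crosses_of_letters_eq {m s d m' s' d' : Monomial X} {p p' w : X}
    (h : Grafting m s d p) (h' : Grafting m' s' d' p') (hn : m.Normal) (hm : m.letters.Nodup)
    (hm' : m'.letters.Nodup) (hs : s.letters = s'.letters) (hroot : s.root = s'.root)
    (hc : Crosses m m'.edges w) :
    (∃ w, Crosses s s'.edges w) ∧ (∃ w, Crosses d d'.edges w) ∧ p' ∈ descendants d.edges p := by
  have hs' : ∀ x ∈ d'.letters, x ∉ s.letters := fun x hd hx =>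
    h'.not_mem hm' (hs ▸ hx) hd
  have hin : ∀ x, x ∈ s'.letters ↔ x ∈ s.letters := fun x => by rw [hs]
  obtain ⟨h1, h2, h3⟩ := h.crosses_restrict hn hm hc (q := p') (by
    intro u v huv hu
    rw [h'.edges_eq, add_single_ne_zero] at huv
    rcases huv with huv | huv | huv
    · exact (hin v).1 (Monomial.mem_letters_of_edges huv).2
    · exact (hs' u (Monomial.mem_letters_of_edges huv).1 hu).elim
    · cases huv
      exact (hin _).1 s'.root_mem_letters) (by
    intro u v huv hv hu
    rw [h'.edges_eq, add_single_ne_zero] at huv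
    rcases huv with huv | huv | huv
    · exact (hu ((hin u).1 (Monomial.mem_letters_of_edges huv).1)).elim
    · exact (hs' v (Monomial.mem_letters_of_edges huv).2 hv).elim
    · cases huv
      exact ⟨rfl, hroot.symm⟩)
  have e1 : restrict {x | x ∈ s.letters} m'.edges = s'.edges := by
    rw [h'.edges_eq, restrict_add, restrict_add,
      restrict_eq_self (A := {x | x ∈ s.letters}) (D := s'.edges) fun u v h =>
        ⟨(hin u).1 (Monomial.mem_letters_of_edges h).1, (hin v).1 (Monomial.mem_letters_of_edges h).2⟩,
      restrict_eq_zero (A := {x | x ∈ s.letters}) fun u v h =>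
        .inl (hs' u (Monomial.mem_letters_of_edges h).1),
      restrict_single_of_not (A := {x | x ∈ s.letters}) (.inl (hs' _ h'.mem_letters)), add_zero,
      add_zero]
  have e2 : restrict {x | x ∈ s.letters}ᶜ m'.edges = d'.edges := by
    rw [h'.edges_eq, restrict_add, restrict_add,
      restrict_eq_zero (A := {x | x ∈ s.letters}ᶜ) (D := s'.edges) fun u v h =>
        .inl (not_not.2 ((hin u).1 (Monomial.mem_letters_of_edges h).1)),
      restrict_eq_self (A := {x | x ∈ s.letters}ᶜ) (D := d'.edges) fun u v h =>
        ⟨hs' u (Monomial.mem_letters_of_edges h).1, hs' v (Monomial.mem_letters_of_edges h).2⟩,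
      restrict_single_of_not (A := {x | x ∈ s.letters}ᶜ)
        (.inr (not_not.2 ((hin _).1 s'.root_mem_letters))), add_zero, zero_add]
  rw [e1] at h1
  rw [e2] at h2
  exact ⟨⟨_, h1⟩, ⟨_, h2⟩, h3⟩

variable [Fintype X]

/-- A crossing sequence is eventually constant if an extreme letter `x` is never the root: the
branch at `x` shrinks until it has a constant set of letters; then both this branch and the rest
of the tree form crossing sequences; and when these are constant, the parent of `x` can only move
towards the root. -/
theorem IsCrossingSeq.eventually_const_of_ne_root {t : Multiset X} {m : ℕ → Monomial X}
    (hm : IsCrossingSeq t m) (ht : t.Nodup) {x : X} (hx : x ∈ t)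
    (hext : (∀ y ∈ t, y ≤ x) ∨ ∀ y ∈ t, x ≤ y) (hroot : ∀ k, (m k).root ≠ x)
    (IH : ∀ (t' : Multiset X) (m' : ℕ → Monomial X), t'.card < t.card → t'.Nodup →
      IsCrossingSeq t' m' → ∃ K, ∀ k ≥ K, m' k = m' K) :
    ∃ K, ∀ k ≥ K, m k = m K := by
  have hnd : ∀ k, (m k).letters.Nodup := fun k => by rw [hm.letters]; exact ht
  choose s d p hg hsx using fun k =>
    exists_grafting (m k) (by rw [hm.letters]; exact hx) (hroot k).symm
  -- Since `x` is extreme, the branch at `x` loses letters or keeps them.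
  have hle : ∀ k, (s (k + 1)).letters ≤ (s k).letters := by
    intro k
    obtain ⟨w, hw⟩ := hm.crosses k
    refine (Multiset.le_iff_subset ((hg (k + 1)).nodup_left (hnd _))).2 fun y hy => ?_
    have h1 := (hg (k + 1)).subset_descendants (hm.normal _) hw
      (by rw [hm.letters, hsx]; exact hext) hy
    rw [hsx, ← hsx k] at h1
    exact (hg k).descendants_subset (hnd k) h1
  obtain ⟨K, hK⟩ := exists_forall_ge_eq_of_antitone (fun k => (s k).letters.card)
    fun k => Multiset.card_le_card (hle k)
  have hsK : ∀ k, (s (K + k)).letters = (s K).letters := by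
    intro k
    refine Multiset.eq_of_le_of_card_le ?_ (hK (K + k) (by omega)).ge
    exact antitone_nat_of_succ_le (f := fun k => (s k).letters) hle (Nat.le_add_right K k)
  have hdK : ∀ k, (d (K + k)).letters = (d K).letters := by
    intro k
    have h1 := (hg (K + k)).letters_eq
    rw [hm.letters, ← hm.letters K, (hg K).letters_eq, hsK k] at h1
    exact (add_left_cancel h1).symm
  have hstep : ∀ k, (∃ w, Crosses (s (K + (k + 1))) (s (K + k)).edges w) ∧
      (∃ w, Crosses (d (K + (k + 1))) (d (K + k)).edges w) ∧
      p (K + k) ∈ descendants (d (K + (k + 1))).edges (p (K + (k + 1))) := by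
    intro k
    obtain ⟨w, hw⟩ := hm.crosses (K + k)
    exact (hg (K + k + 1)).crosses_of_letters_eq (hg (K + k)) (hm.normal _) (hnd _) (hnd _)
      ((hsK (k + 1)).trans (hsK k).symm) (by rw [hsx, hsx]) hw
  have hcard := congrArg Multiset.card ((hm.letters K).symm.trans (hg K).letters_eq)
  rw [Multiset.card_add] at hcard
  have hsn := fun k => ((hg k).normal (hm.normal k)).1
  have hdn := fun k => ((hg k).normal (hm.normal k)).2.1
  obtain ⟨K₁, hK₁⟩ := IH (s K).letters (fun k => s (K + k))
    (by have := (d K).card_letters_pos; omega) ((hg K).nodup_left (hnd K))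
    ⟨fun k => hsn _, hsK, fun k => (hstep k).1⟩
  obtain ⟨K₂, hK₂⟩ := IH (d K).letters (fun k => d (K + k))
    (by have := (s K).card_letters_pos; omega) ((hg K).nodup_right (hnd K))
    ⟨fun k => hdn _, hdK, fun k => (hstep k).2.1⟩
  have hdnd := fun k => (hg k).nodup_right (hnd k)
  -- From `L` on, both the branch at `x` and the rest are constant.
  set L := K + max K₁ K₂ with hL
  have hsL : ∀ k, s (L + k) = s L := fun k => by
    rw [hL, add_assoc, hK₁ (max K₁ K₂ + k) (by omega), ← hK₁ (max K₁ K₂) (by omega)]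
  have hdL : ∀ k, d (L + k) = d L := fun k => by
    rw [hL, add_assoc, hK₂ (max K₁ K₂ + k) (by omega), ← hK₂ (max K₁ K₂) (by omega)]
  have hpL : ∀ k, descendants (d L).edges (p (L + k)) ⊆
      descendants (d L).edges (p (L + (k + 1))) := by
    intro k
    have h1 := (hstep (max K₁ K₂ + k)).2.2
    rw [add_assoc, ← add_assoc K, ← add_assoc K, ← hL, hdL] at h1
    exact descendants_subset_of_mem h1
  have hfin : ∀ k, (descendants (d L).edges (p (L + k))).Finite := fun k => Set.toFinite _
  have hbound : ∀ k, (descendants (d L).edges (p (L + k))).ncard ≤ Fintype.card X := fun k => by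
    rw [← Nat.card_eq_fintype_card]
    exact Set.ncard_le_card _
  -- The branch at the parent of `x` in the constant rest grows, hence stabilizes.
  obtain ⟨M, hM⟩ := exists_forall_ge_eq_of_antitone
    (fun k => Fintype.card X - (descendants (d L).edges (p (L + k))).ncard)
    fun k => Nat.sub_le_sub_left (Set.ncard_le_ncard (hpL k) (hfin _)) _
  have hp : ∀ k ≥ M, p (L + k) = p (L + M) := by
    intro k hk
    have hsub : descendants (d L).edges (p (L + M)) ⊆ descendants (d L).edges (p (L + k)) :=
      monotone_nat_of_le_succ (f := fun k => descendants (d L).edges (p (L + k))) hpL hk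
    have heq : descendants (d L).edges (p (L + M)) = descendants (d L).edges (p (L + k)) := by
      refine Set.eq_of_subset_of_ncard_le hsub ?_ (hfin k)
      have h1 := hM k hk
      have h2 := hbound k
      have h3 := hbound M
      omega
    refine Monomial.descendants_antisymm (hdnd L) ?_ ?_
    · rw [← heq]
      exact mem_descendants_self _ _
    · rw [heq]
      exact mem_descendants_self _ _
  refine ⟨L + M, fun k hk => ?_⟩
  obtain ⟨j, rfl⟩ := Nat.exists_eq_add_of_le (le_trans (Nat.le_add_right L M) hk)
  refine Monomial.eq_of_edges_eq (hm.normal _) (hnd _) (hm.normal _) (hnd _) ?_ ?_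
  · rw [(hg (L + j)).edges_eq, (hg (L + M)).edges_eq, hsL, hsL, hdL, hdL, hp j (by omega)]
  · rw [← (hg (L + j)).root_eq, ← (hg (L + M)).root_eq, hdL, hdL]

/-- Crossing sequences are eventually constant. -/
theorem IsCrossingSeq.eventually_const {t : Multiset X} {m : ℕ → Monomial X} (ht : t.Nodup)
    (hm : IsCrossingSeq t m) : ∃ K, ∀ k ≥ K, m k = m K := by
  induction hc : t.card using Nat.strong_induction_on generalizing t m with
  | _ n ih =>
  subst hc
  have IH : ∀ (t' : Multiset X) (m' : ℕ → Monomial X), t'.card < t.card → t'.Nodup →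
      IsCrossingSeq t' m' → ∃ K, ∀ k ≥ K, m' k = m' K :=
    fun t' m' hlt ht' hm' => ih _ hlt ht' hm' rfl
  have hne : t.toFinset.Nonempty :=
    ⟨_, Multiset.mem_toFinset.2 (hm.letters 0 ▸ (m 0).root_mem_letters)⟩
  have hnd : ∀ k, (m k).letters.Nodup := fun k => by rw [hm.letters]; exact ht
  set x := t.toFinset.max' hne with hx
  set y := t.toFinset.min' hne with hy
  have hxt : x ∈ t := Multiset.mem_toFinset.1 (Finset.max'_mem _ _)
  have hyt : y ∈ t := Multiset.mem_toFinset.1 (Finset.min'_mem _ _)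
  have hmax : ∀ z ∈ t, z ≤ x := fun z hz => Finset.le_max' _ _ (Multiset.mem_toFinset.2 hz)
  have hmin : ∀ z ∈ t, y ≤ z := fun z hz => Finset.min'_le _ _ (Multiset.mem_toFinset.2 hz)
  -- Once the largest letter is not the root, it never is again.
  have hstep : ∀ k, (m (k + 1)).root = x → (m k).root = x := by
    intro k hk
    obtain ⟨w, hw⟩ := hm.crosses k
    have hwx := hw.root_eq (hm.normal _) (.inl (by rw [hm.letters, hk]; exact hmax))
    rw [hk] at hwx
    subst hwx
    refine Monomial.root_eq_of_forall_mem_descendants (hnd k) fun z hz => ?_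
    exact hw.subset_descendants (by rw [hm.letters, ← hm.letters k]; exact hz)
  -- If it is the root throughout, the smallest letter is not, unless there is only one letter.
  by_cases hall : ∀ k, (m k).root = x
  · by_cases hxy : x = y
    · have hvar : ∀ k, m k = .var x := by
        intro k
        cases hmk : m k with
        | var z =>
          have h1 := hall k
          rw [hmk] at h1
          rw [← h1]
          rfl
        | br c a b =>
          have hk := hnd k
          have hlet := hm.letters k
          rw [hmk] at hk hlet
          have h1 : ∀ z ∈ t, z = x := fun z hz =>
            le_antisymm (hmax z hz) (hxy.trans_le (hmin z hz))
          have ha := h1 a.root (hlet ▸ Monomial.mem_letters_br.2 (.inl a.root_mem_letters))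
          have hb := h1 b.root (hlet ▸ Monomial.mem_letters_br.2 (.inr b.root_mem_letters))
          exact (Monomial.not_mem_both hk a.root_mem_letters
            (ha.trans hb.symm ▸ b.root_mem_letters)).elim
      exact ⟨0, fun k _ => by rw [hvar, hvar]⟩
    · exact hm.eventually_const_of_ne_root ht hyt (.inr hmin)
        (fun k => by rw [hall]; exact hxy) IH
  · push Not at hall
    obtain ⟨K, hK⟩ := hall
    have hroot : ∀ k, (m (K + k)).root ≠ x := by
      intro k
      induction k with
      | zero => exact hK
      | succ k ih => exact fun h => ih (hstep _ h)
    obtain ⟨M, hM⟩ := (hm.shift K).eventually_const_of_ne_root ht hxt (.inl hmax) hroot IH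
    refine ⟨K + M, fun k hk => ?_⟩
    obtain ⟨j, rfl⟩ := Nat.exists_eq_add_of_le (le_trans (Nat.le_add_right K M) hk)
    exact hM j (by omega)

end Acyclic

/-! ### Coefficients of the polynomials of normal monomials -/

section Coefficients

variable {X : Type*}

/-- Each vertex of the tree of a monomial has at most one parent. -/
theorem Monomial.parent_unique {m : Monomial X} (hm : m.letters.Nodup) {u u' v : X}
    (h : m.edges (u, v) ≠ 0) (h' : m.edges (u', v) ≠ 0) : u = u' := by
  induction m with
  | var x => simp [edges] at h
  | br c a b iha ihb =>
    have hab := fun x => @not_mem_both _ c a b hm x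
    have hra := a.root_mem_letters
    have hrb := b.root_mem_letters
    have hra' := fun u => a.edges_root (nodup_left hm) u
    have hrb' := fun u => b.edges_root (nodup_right hm) u
    cases c
    · rcases edges_red_ne_zero.1 h with h1 | h1 | h1 <;>
        rcases edges_red_ne_zero.1 h' with h2 | h2 | h2
      · exact iha (nodup_left hm) h1 h2
      · exact (hab _ (mem_letters_of_edges h1).2 (mem_letters_of_edges h2).2).elim
      · cases h2
        exact (hab _ (mem_letters_of_edges h1).2 hrb).elim
      · exact (hab _ (mem_letters_of_edges h2).2 (mem_letters_of_edges h1).2).elim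
      · exact ihb (nodup_right hm) h1 h2
      · cases h2
        exact (h1 (hrb' _)).elim
      · cases h1
        exact (hab _ (mem_letters_of_edges h2).2 hrb).elim
      · cases h1
        exact (h2 (hrb' _)).elim
      · cases h1
        cases h2
        rfl
    · rcases edges_blue_ne_zero.1 h with h1 | h1 | h1 <;>
        rcases edges_blue_ne_zero.1 h' with h2 | h2 | h2
      · exact iha (nodup_left hm) h1 h2
      · exact (hab _ (mem_letters_of_edges h1).2 (mem_letters_of_edges h2).2).elim
      · cases h2
        exact (h1 (hra' _)).elim
      · exact (hab _ (mem_letters_of_edges h2).2 (mem_letters_of_edges h1).2).elim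
      · exact ihb (nodup_right hm) h1 h2
      · cases h2
        exact (hab _ hra (mem_letters_of_edges h1).2).elim
      · cases h1
        exact (h2 (hra' _)).elim
      · cases h1
        exact (hab _ hra (mem_letters_of_edges h2).2).elim
      · cases h1
        cases h2
        rfl

variable (R : Type*) [CommRing R] [LinearOrder X]

theorem coeff_edgeForm_ne_zero {c : Color} {x y : X} {D : X × X →₀ ℕ}
    (h : (edgeForm R c x y).coeff D ≠ 0) :
    (D = Finsupp.single (x, y) 1 ∧ c.Rel x y) ∨ (D = Finsupp.single (y, x) 1 ∧ c.Rel y x) := by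
  classical
  cases c <;> simp only [edgeForm] at h <;> split_ifs at h with h1 h2 <;>
    simp only [MvPolynomial.coeff_neg, MvPolynomial.coeff_X, MvPolynomial.coeff_zero, ne_eq,
      neg_eq_zero, ite_eq_right_iff, not_forall, not_true] at h
  · exact .inl ⟨h.1.symm, h1⟩
  · exact .inr ⟨h.1.symm, h2⟩
  · exact .inl ⟨h.1.symm, h1⟩
  · exact .inr ⟨h.1.symm, h2⟩

theorem exists_of_coeff_sum_ne_zero {α σ : Type*} (s : Multiset α) (f : α → MvPolynomial σ R)
    {D : σ →₀ ℕ} (h : (s.map f).sum.coeff D ≠ 0) : ∃ x ∈ s, (f x).coeff D ≠ 0 := by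
  induction s using Multiset.induction with
  | empty => simp at h
  | cons a s ih =>
    rw [Multiset.map_cons, Multiset.sum_cons, MvPolynomial.coeff_add] at h
    by_cases ha : (f a).coeff D = 0
    · rw [ha, zero_add] at h
      obtain ⟨x, hx, hx'⟩ := ih h
      exact ⟨x, Multiset.mem_cons_of_mem hx, hx'⟩
    · exact ⟨a, Multiset.mem_cons_self _ _, ha⟩

theorem coeff_crossForm_ne_zero {c : Color} {s t : Multiset X} {D : X × X →₀ ℕ}
    (h : (crossForm R c s t).coeff D ≠ 0) :
    ∃ x ∈ s, ∃ y ∈ t, (D = Finsupp.single (x, y) 1 ∧ c.Rel x y) ∨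
      (D = Finsupp.single (y, x) 1 ∧ c.Rel y x) := by
  obtain ⟨x, hx, h⟩ := exists_of_coeff_sum_ne_zero R _ _ h
  obtain ⟨y, hy, h⟩ := exists_of_coeff_sum_ne_zero R _ _ h
  exact ⟨x, hx, y, hy, coeff_edgeForm_ne_zero R h⟩

theorem exists_of_coeff_mul_ne_zero {σ : Type*} {f g : MvPolynomial σ R} {D : σ →₀ ℕ}
    (h : (f * g).coeff D ≠ 0) : ∃ E F, f.coeff E ≠ 0 ∧ g.coeff F ≠ 0 ∧ E + F = D := by
  classical
  rw [MvPolynomial.coeff_mul] at h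
  obtain ⟨⟨E, F⟩, hEF, hne⟩ := Finset.exists_ne_zero_of_sum_ne_zero h
  exact ⟨E, F, left_ne_zero_of_mul hne, right_ne_zero_of_mul hne,
    Finset.HasAntidiagonal.mem_antidiagonal.1 hEF⟩

theorem coeff_mul_of_unique {σ : Type*} {f g : MvPolynomial σ R} {E F : σ →₀ ℕ}
    (h : ∀ E' F', f.coeff E' ≠ 0 → g.coeff F' ≠ 0 → E' + F' = E + F → E' = E ∧ F' = F) :
    (f * g).coeff (E + F) = f.coeff E * g.coeff F := by
  classical
  rw [MvPolynomial.coeff_mul]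
  refine Finset.sum_eq_single (E, F) ?_ ?_
  · rintro ⟨E', F'⟩ hmem hne
    by_contra h0
    obtain ⟨rfl, rfl⟩ := h E' F' (left_ne_zero_of_mul h0) (right_ne_zero_of_mul h0)
      (Finset.HasAntidiagonal.mem_antidiagonal.1 hmem)
    exact hne rfl
  · intro hmem
    exact (hmem (Finset.HasAntidiagonal.mem_antidiagonal.2 rfl)).elim

theorem mem_letters_of_coeff_poly {m : Monomial X} {D : X × X →₀ ℕ}
    (h : (m.poly R).coeff D ≠ 0) {u v : X} (huv : D (u, v) ≠ 0) :
    u ∈ m.letters ∧ v ∈ m.letters := by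
  classical
  induction m generalizing D with
  | var x =>
    rw [Monomial.poly, MvPolynomial.coeff_one] at h
    split_ifs at h with h0
    · subst h0
      simp at huv
    · exact absurd rfl h
  | br c a b iha ihb =>
    obtain ⟨D₀, D', h0, h', rfl⟩ := exists_of_coeff_mul_ne_zero R h
    obtain ⟨D₁, D₂, h1, h2, rfl⟩ := exists_of_coeff_mul_ne_zero R h'
    simp only [Monomial.mem_letters_br]
    obtain ⟨x, hx, y, hy, hxy⟩ := coeff_crossForm_ne_zero R h0
    have : D₀ (u, v) ≠ 0 ∨ D₁ (u, v) ≠ 0 ∨ D₂ (u, v) ≠ 0 := by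
      rw [Finsupp.add_apply, Finsupp.add_apply] at huv
      omega
    rcases this with h | h | h
    · rcases hxy with ⟨rfl, -⟩ | ⟨rfl, -⟩ <;> cases single_one_ne_zero_iff.1 h
      · exact ⟨.inl hx, .inr hy⟩
      · exact ⟨.inr hy, .inl hx⟩
    · exact ⟨.inl (iha h1 h).1, .inl (iha h1 h).2⟩
    · exact ⟨.inr (ihb h2 h).1, .inr (ihb h2 h).2⟩

/-- If a graph `D` in which each vertex has at most one parent occurs in the polynomial of `m`,
then it is a rooted tree that crosses `m`. -/
theorem exists_crosses_of_coeff {m : Monomial X} (hm : m.letters.Nodup) {D : X × X →₀ ℕ}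
    (hD : ∀ u u' v, D (u, v) ≠ 0 → D (u', v) ≠ 0 → u = u') (h : (m.poly R).coeff D ≠ 0) :
    ∃ w, Crosses m D w := by
  classical
  induction m generalizing D with
  | var x =>
    rw [Monomial.poly, MvPolynomial.coeff_one] at h
    split_ifs at h with h0
    · subst h0
      exact ⟨x, .var x⟩
    · exact absurd rfl h
  | br c a b iha ihb =>
    obtain ⟨D₀, D', h0, h', rfl⟩ := exists_of_coeff_mul_ne_zero R h
    obtain ⟨D₁, D₂, h1, h2, rfl⟩ := exists_of_coeff_mul_ne_zero R h'
    rw [add_comm] at hD ⊢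
    have hle1 : ∀ {e}, D₁ e ≠ 0 → (D₁ + D₂ + D₀) e ≠ 0 := fun {e} h => by
      rw [Finsupp.add_apply, Finsupp.add_apply]
      omega
    have hle2 : ∀ {e}, D₂ e ≠ 0 → (D₁ + D₂ + D₀) e ≠ 0 := fun {e} h => by
      rw [Finsupp.add_apply, Finsupp.add_apply]
      omega
    have hle0 : ∀ {e}, D₀ e ≠ 0 → (D₁ + D₂ + D₀) e ≠ 0 := fun {e} h => by
      rw [Finsupp.add_apply, Finsupp.add_apply]
      omega
    obtain ⟨w, hw⟩ := iha (Monomial.nodup_left hm)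
      (fun u u' v h h' => hD u u' v (hle1 h) (hle1 h')) h1
    obtain ⟨w', hw'⟩ := ihb (Monomial.nodup_right hm)
      (fun u u' v h h' => hD u u' v (hle2 h) (hle2 h')) h2
    have hab := fun x => @Monomial.not_mem_both _ c a b hm x
    obtain ⟨x, hx, y, hy, ⟨rfl, hc⟩ | ⟨rfl, hc⟩⟩ := coeff_crossForm_ne_zero R h0
    -- The edge between the two parts ends in a root, since any other vertex already has a parent.
    · obtain rfl : y = w' := by
        by_contra hne
        obtain ⟨u, hu⟩ := hw'.exists_parent hy hne
        have := hD u x y (hle2 hu) (hle0 (single_one_ne_zero_iff.2 rfl))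
        subst this
        exact hab _ hx (hw'.mem_letters hu).1
      exact ⟨w, .left hw hw' hx hc⟩
    · obtain rfl : x = w := by
        by_contra hne
        obtain ⟨u, hu⟩ := hw.exists_parent hx hne
        have := hD u y x (hle1 hu) (hle0 (single_one_ne_zero_iff.2 rfl))
        subst this
        exact hab _ (hw.mem_letters hu).1 hy
      exact ⟨w', .right hw hw' hy hc⟩

theorem sum_map_eq_of_forall_ne {α : Type*} {M : Type*} [AddCommMonoid M] {s : Multiset α}
    (hs : s.Nodup) {f : α → M} {a : α} (ha : a ∈ s) (h : ∀ x ∈ s, x ≠ a → f x = 0) :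
    (s.map f).sum = f a := by
  obtain ⟨t, rfl⟩ := Multiset.exists_cons_of_mem ha
  rw [Multiset.nodup_cons] at hs
  rw [Multiset.map_cons, Multiset.sum_cons, Multiset.sum_eq_zero, add_zero]
  intro y hy
  obtain ⟨x, hx, rfl⟩ := Multiset.mem_map.1 hy
  exact h x (Multiset.mem_cons_of_mem hx) fun hxa => hs.1 (hxa ▸ hx)

theorem coeff_crossForm {c : Color} {s t : Multiset X} (hs : s.Nodup) (ht : t.Nodup) {x y : X}
    (hx : x ∈ s) (hy : y ∈ t) (hst : Disjoint s t) {D : X × X →₀ ℕ}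
    (hD : D = Finsupp.single (x, y) 1 ∨ D = Finsupp.single (y, x) 1) :
    (crossForm R c s t).coeff D = (edgeForm R c x y).coeff D := by
  have key : ∀ x' ∈ s, ∀ y' ∈ t, (edgeForm R c x' y').coeff D ≠ 0 → x' = x ∧ y' = y := by
    intro x' hx' y' hy' h
    have h1 : ∀ {p q : X × X}, Finsupp.single p 1 = (Finsupp.single q 1 : X × X →₀ ℕ) → p = q :=
      fun h => Finsupp.single_left_injective one_ne_zero h
    have hne : ∀ z ∈ s, ∀ z' ∈ t, z ≠ z' := fun z hz z' hz' heq =>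
      Multiset.disjoint_left.1 hst hz (heq ▸ hz')
    rcases coeff_edgeForm_ne_zero R h with ⟨h2, -⟩ | ⟨h2, -⟩ <;> rcases hD with rfl | rfl <;>
      have h3 := h1 h2 <;> rw [Prod.mk.injEq] at h3
    · exact ⟨h3.1.symm, h3.2.symm⟩
    · exact (hne _ hx' _ hy h3.1.symm).elim
    · exact (hne _ hx _ hy' h3.1).elim
    · exact ⟨h3.2.symm, h3.1.symm⟩
  have hmap : ∀ {α : Type _} (s : Multiset α) (f : α → MvPolynomial (X × X) R),
      (s.map f).sum.coeff D = (s.map fun a => (f a).coeff D).sum := by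
    intro α s f
    rw [← MvPolynomial.lcoeff_apply, map_multiset_sum, Multiset.map_map]
    rfl
  rw [crossForm, hmap, sum_map_eq_of_forall_ne hs hx, hmap, sum_map_eq_of_forall_ne ht hy]
  · intro y' hy' hne
    by_contra h
    exact hne (key x hx y' hy' h).2
  · intro x' hx' hne
    by_contra h
    obtain ⟨y', hy', h'⟩ := exists_of_coeff_sum_ne_zero R _ _ h
    exact hne (key x' hx' y' hy' h').1

/-- The tree of a normal monomial occurs in its polynomial with coefficient `1` or `-1`. -/
theorem isUnit_coeff_poly {m : Monomial X} (hn : m.Normal) (hm : m.letters.Nodup) :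
    IsUnit ((m.poly R).coeff m.edges) := by
  induction m with
  | var x => simp [Monomial.poly, Monomial.edges]
  | br c a b iha ihb =>
    have hna : a.Normal := by cases c <;> exact hn.1
    have hnb : b.Normal := by cases c <;> exact hn.2.1
    have hma := Monomial.nodup_left hm
    have hmb := Monomial.nodup_right hm
    have hab := fun x => @Monomial.not_mem_both _ c a b hm x
    have hdisj : Disjoint a.letters b.letters := (Multiset.nodup_add.1 hm).2.2
    obtain ⟨e, he, hunit, hrel⟩ : ∃ e : X × X,
        (Monomial.br c a b).edges = Finsupp.single e 1 + (a.edges + b.edges) ∧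
        IsUnit ((edgeForm R c a.root b.root).coeff (Finsupp.single e 1)) ∧
        (e = (a.root, b.root) ∨ e = (b.root, a.root)) := by
      cases c
      · refine ⟨(a.root, b.root), by rw [Monomial.edges]; abel, ?_, .inl rfl⟩
        rw [edgeForm, if_pos hn.2.2.1, MvPolynomial.coeff_X, if_pos rfl]
        exact isUnit_one
      · refine ⟨(b.root, a.root), by rw [Monomial.edges]; abel, ?_, .inr rfl⟩
        rw [edgeForm, if_neg hn.2.2.1.not_gt, if_pos hn.2.2.1, MvPolynomial.coeff_neg,
          MvPolynomial.coeff_X, if_pos rfl]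
        exact isUnit_one.neg
    -- The edges within `a` and within `b` separate the three factors.
    have sep : ∀ {D₀ D₁ D₂ : X × X →₀ ℕ} {x y : X}, x ∈ a.letters → y ∈ b.letters →
        (D₀ = Finsupp.single (x, y) 1 ∨ D₀ = Finsupp.single (y, x) 1) →
        (∀ u v, D₁ (u, v) ≠ 0 → u ∈ a.letters ∧ v ∈ a.letters) →
        (∀ u v, D₂ (u, v) ≠ 0 → u ∈ b.letters ∧ v ∈ b.letters) →
        restrict {x | x ∈ a.letters} (D₀ + (D₁ + D₂)) = D₁ ∧
          restrict {x | x ∈ b.letters} (D₀ + (D₁ + D₂)) = D₂ := by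
      intro D₀ D₁ D₂ x y hx hy h0 h1 h2
      rw [restrict_add, restrict_add, restrict_add, restrict_add,
        restrict_eq_self (A := {x | x ∈ a.letters}) (D := D₁) h1,
        restrict_eq_self (A := {x | x ∈ b.letters}) (D := D₂) h2,
        restrict_eq_zero (A := {x | x ∈ a.letters}) (D := D₂)
          fun u v h => .inl fun hu => hab u hu (h2 u v h).1,
        restrict_eq_zero (A := {x | x ∈ b.letters}) (D := D₁)
          fun u v h => .inl fun hu => hab u (h1 u v h).1 hu]
      have hxb : x ∉ b.letters := fun h => hab x hx h
      have hya : y ∉ a.letters := fun h => hab y h hy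
      rcases h0 with rfl | rfl
      · rw [restrict_single_of_not (A := {x | x ∈ a.letters}) (.inr hya),
          restrict_single_of_not (A := {x | x ∈ b.letters}) (.inl hxb)]
        simp
      · rw [restrict_single_of_not (A := {x | x ∈ a.letters}) (.inl hya),
          restrict_single_of_not (A := {x | x ∈ b.letters}) (.inr hxb)]
        simp
    have hsep := sep (D₀ := Finsupp.single e 1) a.root_mem_letters b.root_mem_letters
      (by rcases hrel with rfl | rfl <;> simp)
      (fun u v h => Monomial.mem_letters_of_edges (m := a) h)
      (fun u v h => Monomial.mem_letters_of_edges (m := b) h)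
    have hsep' : ∀ {D₀ D₁ D₂ : X × X →₀ ℕ}, (crossForm R c a.letters b.letters).coeff D₀ ≠ 0 →
        (a.poly R).coeff D₁ ≠ 0 → (b.poly R).coeff D₂ ≠ 0 →
        D₀ + (D₁ + D₂) = Finsupp.single e 1 + (a.edges + b.edges) →
        D₁ = a.edges ∧ D₂ = b.edges := by
      intro D₀ D₁ D₂ h0 h1 h2 heq
      obtain ⟨x, hx, y, hy, hxy⟩ := coeff_crossForm_ne_zero R h0
      have h := sep hx hy (hxy.imp And.left And.left)
        (fun u v h => mem_letters_of_coeff_poly R h1 h)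
        (fun u v h => mem_letters_of_coeff_poly R h2 h)
      rw [heq] at h
      exact ⟨h.1.symm.trans hsep.1, h.2.symm.trans hsep.2⟩
    have hcross : IsUnit ((crossForm R c a.letters b.letters).coeff (Finsupp.single e 1)) := by
      rw [coeff_crossForm R hma hmb a.root_mem_letters b.root_mem_letters hdisj
        (by rcases hrel with rfl | rfl <;> simp)]
      exact hunit
    rw [he, Monomial.poly, coeff_mul_of_unique, coeff_mul_of_unique]
    · exact hcross.mul ((iha hna hma).mul (ihb hnb hmb))
    · intro D₁ D₂ h1 h2 heq
      have : Nontrivial R := nontrivial_of_ne _ _ h1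
      exact hsep' hcross.ne_zero h1 h2 (by rw [heq])
    · intro D₀ D' h0 h' heq
      obtain ⟨D₁, D₂, h1, h2, rfl⟩ := exists_of_coeff_mul_ne_zero R h'
      obtain ⟨rfl, rfl⟩ := hsep' h0 h1 h2 heq
      exact ⟨add_right_cancel heq, rfl⟩

variable [Fintype X]

/-- Distinct normal monomials on the same letters are linearly independent. In a dependency, each
monomial `m` with a non-zero coefficient yields another one, which is crossed by the tree of `m`;
this contradicts the fact that crossing sequences are eventually constant. -/
theorem linearIndependent_eval {ι : Type*} (f : ι → Monomial X) (hf : Function.Injective f)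
    (t : Multiset X) (ht : t.Nodup) (hn : ∀ i, (f i).Normal) (hlet : ∀ i, (f i).letters = t) :
    LinearIndependent R fun i => (f i).eval R := by
  classical
  rw [linearIndependent_iff']
  intro s g hsum i hi
  by_contra hgi
  have hnd : ∀ i, (f i).letters.Nodup := fun i => by rw [hlet]; exact ht
  have hnext : ∀ i : {i // i ∈ s ∧ g i ≠ 0}, ∃ j : {i // i ∈ s ∧ g i ≠ 0}, j ≠ i ∧
      ∃ w, Crosses (f j) (f i).edges w := by
    rintro ⟨i, hi, hgi⟩
    have h := congrArg (coeffFunctional R t (f i).edges) hsum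
    have hcoeff : ∀ j, coeffFunctional R t (f i).edges ((f j).eval R) =
        ((f j).poly R).coeff (f i).edges := fun j => by
      rw [← hlet j, coeffFunctional_eval]
    simp only [map_sum, map_smul, hcoeff, map_zero, smul_eq_mul] at h
    rw [← Finset.add_sum_erase _ _ hi] at h
    have hne : ∑ j ∈ s.erase i, g j * ((f j).poly R).coeff (f i).edges ≠ 0 := by
      intro h0
      rw [h0, add_zero] at h
      exact hgi ((isUnit_coeff_poly R (hn i) (hnd i)).mul_left_eq_zero.1 h)
    obtain ⟨j, hj, hgj⟩ := Finset.exists_ne_zero_of_sum_ne_zero hne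
    refine ⟨⟨j, (Finset.mem_erase.1 hj).2, left_ne_zero_of_mul hgj⟩, ?_, ?_⟩
    · exact fun h => (Finset.mem_erase.1 hj).1 (congrArg Subtype.val h)
    · exact exists_crosses_of_coeff R (hnd j)
        (fun u u' v h h' => Monomial.parent_unique (hnd i) h h') (right_ne_zero_of_mul hgj)
  choose next hne hcross using hnext
  let seq : ℕ → {i // i ∈ s ∧ g i ≠ 0} := fun k => next^[k] ⟨i, hi, hgi⟩
  have hseq : ∀ k, seq (k + 1) = next (seq k) := fun k => Function.iterate_succ_apply' _ _ _
  have hcs : IsCrossingSeq t fun k => f (seq k) :=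
    ⟨fun k => hn _, fun k => hlet _, fun k => by rw [hseq]; exact hcross (seq k)⟩
  obtain ⟨K, hK⟩ := hcs.eventually_const ht
  refine hne (seq K) ?_
  rw [← hseq]
  exact Subtype.ext (hf (hK (K + 1) (by omega)))

end Coefficients

/-! ### The number of rooted trees -/

section Cayley

variable {X : Type*}

/-- The functions that describe rooted forests with set of roots `C`: a vertex which is not a root
is sent to its parent, and the roots are fixed. -/
def IsRootedForest (C : Finset X) (f : X → X) : Prop :=
  (∀ c ∈ C, f c = c) ∧ ∀ x, ∃ k, f^[k] x ∈ C

theorem IsRootedForest.eq_of_iterate {C : Finset X} {f : X → X} (hf : IsRootedForest C f)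
    {x v w : X} (hv : v ∈ C) (hw : w ∈ C) {j k : ℕ} (hj : f^[j] x = v) (hk : f^[k] x = w) :
    v = w := by
  wlog hjk : j ≤ k generalizing j k v w
  · exact (this hw hv hk hj (by omega)).symm
  obtain ⟨i, rfl⟩ := Nat.exists_eq_add_of_le' hjk
  rw [Function.iterate_add_apply, hj, Function.iterate_fixed (hf.1 v hv)] at hk
  exact hk

theorem exists_iterate_update_mem {f : X → X} {v y x : X} {C : Finset X} [DecidableEq X]
    (h : ∃ k, f^[k] x ∈ insert v C) :
    ∃ k, (Function.update f v y)^[k] x ∈ insert v C := by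
  obtain ⟨k, hk⟩ := h
  induction k generalizing x with
  | zero => exact ⟨0, hk⟩
  | succ k ih =>
    by_cases hx : x = v
    · exact ⟨0, by simp [hx]⟩
    · obtain ⟨j, hj⟩ := ih (by rwa [Function.iterate_succ_apply] at hk)
      exact ⟨j + 1, by rwa [Function.iterate_succ_apply, Function.update_of_ne hx]⟩

/-- The graph of the edges between a vertex and its parent. -/
def parentGraph (f : X → X) : SimpleGraph X := SimpleGraph.fromRel fun x y => f x = y

theorem parentGraph_adj {f : X → X} {x y : X} :
    (parentGraph f).Adj x y ↔ x ≠ y ∧ (f x = y ∨ f y = x) := SimpleGraph.fromRel_adj _ _ _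

theorem parentGraph_reachable_iterate (f : X → X) (x : X) (k : ℕ) :
    (parentGraph f).Reachable x (f^[k] x) := by
  induction k with
  | zero => exact SimpleGraph.Reachable.refl _
  | succ k ih =>
    rw [Function.iterate_succ_apply']
    by_cases h : f^[k] x = f (f^[k] x)
    · rwa [← h]
    · exact ih.trans (SimpleGraph.Adj.reachable (parentGraph_adj.2 ⟨h, .inl rfl⟩))

/-- The parent function of a rooted tree is determined by its graph. -/
theorem IsRootedForest.eq_of_parentGraph_eq {r : X} {f g : X → X} (hf : IsRootedForest {r} f)
    (hg : IsRootedForest {r} g) (h : parentGraph f = parentGraph g) : f = g := by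
  have hfr : f r = r := hf.1 r (Finset.mem_singleton_self r)
  have hgr : g r = r := hg.1 r (Finset.mem_singleton_self r)
  have hfix : ∀ x, f x = x → x = r := fun x hx => by
    obtain ⟨k, hk⟩ := hf.2 x
    rw [Function.iterate_fixed hx] at hk
    exact Finset.mem_singleton.1 hk
  -- If `f` and `g` differ at `x`, the edge from `x` to `f x` points the other way for `g`, and then
  -- they differ at `f x` as well.
  have hstep : ∀ x, f x ≠ g x → f (f x) ≠ g (f x) := by
    intro x hx heq
    have hxr : x ≠ r := fun h => hx (by rw [h, hfr, hgr])
    have hadj : (parentGraph g).Adj x (f x) := by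
      rw [← h, parentGraph_adj]
      exact ⟨fun h => hxr (hfix x h.symm), .inl rfl⟩
    obtain ⟨-, h1 | h1⟩ := parentGraph_adj.1 hadj
    · exact hx h1.symm
    · rw [h1] at heq
      obtain ⟨k, hk⟩ := hf.2 x
      have hper : ∀ k, f^[k] x = x ∨ f^[k] x = f x := by
        intro k
        induction k with
        | zero => exact .inl rfl
        | succ k ih =>
          rw [Function.iterate_succ_apply']
          rcases ih with ih | ih <;> rw [ih]
          · exact .inr rfl
          · exact .inl heq
      rcases hper k with h2 | h2 <;> rw [h2, Finset.mem_singleton] at hk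
      · exact hxr hk
      · rw [hk, hfr] at heq
        exact hxr heq.symm
  funext x
  by_contra hx
  obtain ⟨k, hk⟩ := hf.2 x
  have : f (f^[k] x) ≠ g (f^[k] x) := by
    clear hk
    induction k with
    | zero => exact hx
    | succ k ih =>
      rw [Function.iterate_succ_apply']
      exact hstep _ ih
  rw [Finset.mem_singleton.1 hk, hfr, hgr] at this
  exact this rfl

variable [Fintype X]

/-- A connected graph is a tree if its edges join the vertices other than `r` to their images under
a function. -/
theorem isTree_of_connected_of_forall_adj {G : SimpleGraph X} (hG : G.Connected) (r : X)
    (f : X → X) (h : ∀ u v, G.Adj u v → (u ≠ r ∧ f u = v) ∨ (v ≠ r ∧ f v = u)) : G.IsTree := by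
  refine SimpleGraph.isTree_iff_connected_and_card.2
    ⟨hG, le_antisymm ?_ hG.card_vert_le_card_edgeSet_add_one⟩
  have hsub : G.edgeSet ⊆ (fun x => s(x, f x)) '' {x | x ≠ r} := by
    intro e he
    induction e with
    | _ u v =>
    rcases h u v he with ⟨h1, h2⟩ | ⟨h1, h2⟩
    · exact ⟨u, h1, by simp [h2]⟩
    · exact ⟨v, h1, by simp [h2, Sym2.eq_swap]⟩
  have h1 : G.edgeSet.ncard ≤ ({x | x ≠ r} : Set X).ncard :=
    (Set.ncard_le_ncard hsub (Set.toFinite _)).trans (Set.ncard_image_le (Set.toFinite _))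
  have h2 : ({x | x ≠ r} : Set X).ncard + 1 = Nat.card X := by
    have := Set.ncard_compl ({r} : Set X)
    rw [Set.ncard_singleton] at this
    have hpos : 0 < Nat.card X := Nat.card_pos_iff.2 ⟨⟨r⟩, inferInstance⟩
    change ({r} : Set X)ᶜ.ncard + 1 = _
    omega
  rw [Nat.card_coe_set_eq]
  omega

theorem IsRootedForest.isTree {r : X} {f : X → X} (hf : IsRootedForest {r} f) :
    (parentGraph f).IsTree := by
  have hr : f r = r := hf.1 r (Finset.mem_singleton_self r)
  have hreach : ∀ x, (parentGraph f).Reachable x r := fun x => by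
    obtain ⟨k, hk⟩ := hf.2 x
    rw [← Finset.mem_singleton.1 hk]
    exact parentGraph_reachable_iterate f x k
  have : Nonempty X := ⟨r⟩
  refine isTree_of_connected_of_forall_adj
    ⟨fun x y => (hreach x).trans (hreach y).symm⟩ r f fun u v huv => ?_
  obtain ⟨hne, h | h⟩ := parentGraph_adj.1 huv
  · exact .inl ⟨fun hu => hne (by rw [← h, hu, hr]), h⟩
  · exact .inr ⟨fun hv => hne (by rw [← h, hv, hr]), h⟩

open Classical in
/-- The finite set of all rooted forests with set of roots `C`. -/
noncomputable def rootedForests (C : Finset X) : Finset (X → X) :=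
  Finset.univ.filter (IsRootedForest C)

open Classical in
/-- The vertices of the tree with root `v` of the forest `f`. -/
noncomputable def treeAt (f : X → X) (v : X) : Finset X :=
  Finset.univ.filter fun x => ∃ k, f^[k] x = v

theorem mem_rootedForests {C : Finset X} {f : X → X} :
    f ∈ rootedForests C ↔ IsRootedForest C f := by
  simp [rootedForests]

theorem mem_treeAt {f : X → X} {v x : X} : x ∈ treeAt f v ↔ ∃ k, f^[k] x = v := by
  simp [treeAt]

variable [DecidableEq X]

theorem sum_card_treeAt {C : Finset X} {f : X → X} (hf : IsRootedForest C f) :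
    ∑ v ∈ C, (treeAt f v).card = Fintype.card X := by
  rw [← Finset.card_biUnion, ← Finset.card_univ]
  · congr 1
    ext x
    obtain ⟨k, hk⟩ := hf.2 x
    simp only [Finset.mem_biUnion, mem_treeAt, Finset.mem_univ, iff_true]
    exact ⟨_, hk, k, rfl⟩
  · intro v hv w hw hne
    refine Finset.disjoint_left.2 fun x h1 h2 => hne ?_
    obtain ⟨j, hj⟩ := mem_treeAt.1 h1
    obtain ⟨k, hk⟩ := mem_treeAt.1 h2
    exact hf.eq_of_iterate hv hw hj hk

/-- Relabelling by the transposition of two roots shows that all roots have trees of the same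
average size. -/
theorem sum_card_treeAt_eq {C : Finset X} {v w : X} (hv : v ∈ C) (hw : w ∈ C) :
    ∑ f ∈ rootedForests C, (treeAt f v).card = ∑ f ∈ rootedForests C, (treeAt f w).card := by
  let σ := Equiv.swap v w
  have hσ : ∀ x, σ (σ x) = x := Equiv.swap_apply_self v w
  have hσC : ∀ x, x ∈ C → σ x ∈ C := by
    intro x hx
    simp only [σ, Equiv.swap_apply_def]
    split_ifs <;> assumption
  have hiter : ∀ (f : X → X) k x, (fun x => σ (f (σ x)))^[k] x = σ (f^[k] (σ x)) := by
    intro f k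
    induction k with
    | zero => intro x; simp [hσ]
    | succ k ih => intro x; rw [Function.iterate_succ_apply, ih, hσ, Function.iterate_succ_apply]
  have hmem : ∀ f ∈ rootedForests C, (fun x => σ (f (σ x))) ∈ rootedForests C := by
    intro f hf
    rw [mem_rootedForests] at hf ⊢
    refine ⟨fun c hc => ?_, fun x => ?_⟩
    · simp only [hf.1 _ (hσC c hc), hσ]
    · obtain ⟨k, hk⟩ := hf.2 (σ x)
      exact ⟨k, by rw [hiter]; exact hσC _ hk⟩
  refine Finset.sum_nbij' (fun f x => σ (f (σ x))) (fun f x => σ (f (σ x))) hmem hmem ?_ ?_ ?_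
  · intro f _
    funext x
    simp only [hσ]
  · intro f _
    funext x
    simp only [hσ]
  · intro f _
    refine Finset.card_bij (fun x _ => σ x) ?_ ?_ ?_
    · intro x hx
      obtain ⟨k, hk⟩ := mem_treeAt.1 hx
      exact mem_treeAt.2 ⟨k, by rw [hiter, hσ, hk]; exact Equiv.swap_apply_left v w⟩
    · intro x _ y _ h
      exact σ.injective h
    · intro y hy
      obtain ⟨k, hk⟩ := mem_treeAt.1 hy
      refine ⟨σ y, mem_treeAt.2 ⟨k, ?_⟩, hσ y⟩
      rw [hiter] at hk
      rw [← hσ (f^[k] (σ y)), hk]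
      exact Equiv.swap_apply_right v w

/-- Attaching the tree at the root `v` to a vertex `y` of another tree. -/
theorem IsRootedForest.update {C : Finset X} {v y : X} (hv : v ∉ C) {f : X → X}
    (hf : IsRootedForest (insert v C) f) (hy : y ∉ treeAt f v) :
    IsRootedForest C (Function.update f v y) := by
  have hy' : ∀ k, f^[k] y ≠ v := fun k hk => hy (mem_treeAt.2 ⟨k, hk⟩)
  have hiter : ∀ k, (Function.update f v y)^[k] y = f^[k] y := by
    intro k
    induction k with
    | zero => rfl
    | succ k ih =>
      rw [Function.iterate_succ_apply', ih, Function.update_of_ne (hy' k),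
        Function.iterate_succ_apply']
  refine ⟨fun c hc => ?_, fun x => ?_⟩
  · rw [Function.update_of_ne (ne_of_mem_of_not_mem hc hv), hf.1 c (Finset.mem_insert_of_mem hc)]
  · obtain ⟨k, hk⟩ := exists_iterate_update_mem (y := y) (hf.2 x)
    rcases Finset.mem_insert.1 hk with hk | hk
    · obtain ⟨j, hj⟩ := hf.2 y
      refine ⟨j + (1 + k), ?_⟩
      rw [Function.iterate_add_apply, Function.iterate_add_apply, hk, Function.iterate_one,
        Function.update_self, hiter]
      exact (Finset.mem_insert.1 hj).resolve_left (hy' j)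
    · exact ⟨k, hk⟩

/-- Cutting the edge from `v` to its parent. -/
theorem IsRootedForest.cut {C : Finset X} {v : X} (hv : v ∉ C) {g : X → X}
    (hg : IsRootedForest C g) :
    IsRootedForest (insert v C) (Function.update g v v) ∧
      g v ∉ treeAt (Function.update g v v) v := by
  refine ⟨⟨fun c hc => ?_, fun x => ?_⟩, fun hmem => ?_⟩
  · by_cases h : c = v
    · rw [h, Function.update_self]
    · rw [Function.update_of_ne h, hg.1 c (Finset.mem_of_mem_insert_of_ne hc h)]
  · obtain ⟨k, hk⟩ := hg.2 x
    exact exists_iterate_update_mem ⟨k, Finset.mem_insert_of_mem hk⟩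
  · obtain ⟨k, hk⟩ := mem_treeAt.1 hmem
    have h1 : ∀ k x, (Function.update g v v)^[k] x = v → ∃ j, g^[j] x = v := by
      intro k
      induction k with
      | zero => exact fun x hx => ⟨0, hx⟩
      | succ k ih =>
        intro x hx
        by_cases hxv : x = v
        · exact ⟨0, hxv⟩
        · rw [Function.iterate_succ_apply, Function.update_of_ne hxv] at hx
          obtain ⟨j, hj⟩ := ih _ hx
          exact ⟨j + 1, hj⟩
    -- Otherwise `v` would lie on a cycle of `g`.
    obtain ⟨j, hj⟩ := h1 k _ hk
    have hper : Function.IsPeriodicPt g (j + 1) v := hj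
    obtain ⟨i, hi⟩ := hg.2 v
    have h2 : g^[(j + 1) * i] v = v := (hper.mul_const i)
    have h3 : (j + 1) * i = j * i + i := by ring
    rw [h3, Function.iterate_add_apply, Function.iterate_fixed (hg.1 _ hi)] at h2
    exact hv (h2 ▸ hi)

theorem card_rootedForests_eq_sum {C : Finset X} {v : X} (hv : v ∉ C) :
    (rootedForests C).card =
      ∑ f ∈ rootedForests (insert v C), (treeAt f v)ᶜ.card := by
  rw [← Finset.card_sigma]
  refine Finset.card_bij' (fun g _ => ⟨Function.update g v v, g v⟩)
    (fun p _ => Function.update p.1 v p.2) ?_ ?_ ?_ ?_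
  · intro g hg
    have h := (mem_rootedForests.1 hg).cut hv
    exact Finset.mem_sigma.2 ⟨mem_rootedForests.2 h.1, Finset.mem_compl.2 h.2⟩
  · rintro ⟨f, y⟩ hp
    obtain ⟨h1, h2⟩ := Finset.mem_sigma.1 hp
    exact mem_rootedForests.2 ((mem_rootedForests.1 h1).update hv (Finset.mem_compl.1 h2))
  · intro g _
    simp
  · rintro ⟨f, y⟩ hp
    have h1 := mem_rootedForests.1 (Finset.mem_sigma.1 hp).1
    have hfv : f v = v := h1.1 v (Finset.mem_insert_self _ _)
    have : Function.update f v v = f := Function.update_eq_self_iff.2 hfv.symm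
    simp [this]

theorem card_rootedForests_insert {C : Finset X} {v : X} (hv : v ∉ C) :
    (C.card + 1) * (rootedForests C).card =
      C.card * (Fintype.card X * (rootedForests (insert v C)).card) := by
  have h1 : (rootedForests C).card + ∑ f ∈ rootedForests (insert v C), (treeAt f v).card =
      Fintype.card X * (rootedForests (insert v C)).card := by
    rw [card_rootedForests_eq_sum hv, ← Finset.sum_add_distrib, mul_comm]
    exact Finset.sum_const_nat fun f _ => Finset.card_compl_add_card _
  have h2 : (C.card + 1) * ∑ f ∈ rootedForests (insert v C), (treeAt f v).card =
      Fintype.card X * (rootedForests (insert v C)).card := by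
    have h3 : ∑ w ∈ insert v C, ∑ f ∈ rootedForests (insert v C), (treeAt f w).card =
        Fintype.card X * (rootedForests (insert v C)).card := by
      rw [Finset.sum_comm, mul_comm]
      exact Finset.sum_const_nat fun f hf => sum_card_treeAt (mem_rootedForests.1 hf)
    rw [← h3, Finset.sum_congr rfl fun w hw =>
      sum_card_treeAt_eq hw (Finset.mem_insert_self v C), Finset.sum_const,
      Finset.card_insert_of_notMem hv, smul_eq_mul]
  nlinarith

/-- The number of rooted forests with a given set of roots. -/
theorem card_mul_card_rootedForests (C : Finset X) :
    Fintype.card X * (rootedForests C).card =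
      C.card * Fintype.card X ^ (Fintype.card X - C.card) := by
  induction hk : Fintype.card X - C.card generalizing C with
  | zero =>
    have hC : C = Finset.univ := by
      rw [← Finset.card_eq_iff_eq_univ]
      have := Finset.card_le_univ C
      omega
    subst hC
    have : rootedForests (Finset.univ : Finset X) = {id} := by
      ext f
      rw [mem_rootedForests, Finset.mem_singleton]
      refine ⟨fun h => funext fun x => h.1 x (Finset.mem_univ x), ?_⟩
      rintro rfl
      exact ⟨fun _ _ => rfl, fun x => ⟨0, Finset.mem_univ _⟩⟩
    rw [this]
    simp
  | succ k ih =>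
    obtain ⟨v, hv⟩ : ∃ v, v ∉ C := by
      by_contra! h
      rw [(Finset.eq_univ_iff_forall).2 h, Finset.card_univ] at hk
      omega
    have hcard := Finset.card_insert_of_notMem hv
    have h1 := ih (insert v C) (by omega)
    have h2 := card_rootedForests_insert hv
    rw [hcard] at h1
    refine Nat.eq_of_mul_eq_mul_left (Nat.succ_pos C.card) ?_
    calc (C.card + 1) * (Fintype.card X * (rootedForests C).card)
        = Fintype.card X * ((C.card + 1) * (rootedForests C).card) := by ring
      _ = Fintype.card X * C.card * (Fintype.card X * (rootedForests (insert v C)).card) := by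
        rw [h2]; ring
      _ = (C.card + 1) * (C.card * Fintype.card X ^ (k + 1)) := by rw [h1]; ring

theorem exists_parentGraph_eq {G : SimpleGraph X} (hG : G.IsTree) (r : X) :
    ∃ f, IsRootedForest {r} f ∧ parentGraph f = G := by
  have hclose : ∀ x, x ≠ r → ∃ y, G.Adj x y ∧ G.dist y r < G.dist x r := by
    intro x hx
    obtain ⟨p, hp⟩ := hG.connected.exists_walk_length_eq_dist x r
    cases p with
    | nil => exact absurd rfl hx
    | cons h q =>
      refine ⟨_, h, ?_⟩
      rw [← hp, SimpleGraph.Walk.length_cons]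
      exact Nat.lt_succ_of_le (SimpleGraph.dist_le q)
  classical
  choose! p hp using hclose
  let f : X → X := fun x => if x = r then r else p x
  have hfr : f r = r := if_pos rfl
  have hf : ∀ x, x ≠ r → f x = p x := fun x hx => if_neg hx
  have hforest : IsRootedForest {r} f := by
    refine ⟨fun c hc => by rw [Finset.mem_singleton.1 hc, hfr], fun x => ?_⟩
    induction hd : G.dist x r using Nat.strong_induction_on generalizing x with
    | _ d ih =>
    by_cases hx : x = r
    · exact ⟨0, Finset.mem_singleton.2 hx⟩
    · obtain ⟨k, hk⟩ := ih _ (hd ▸ (hp x hx).2) (p x) rfl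
      exact ⟨k + 1, by rwa [Function.iterate_succ_apply, hf x hx]⟩
  refine ⟨f, hforest, ?_⟩
  have hle : parentGraph f ≤ G := by
    have key : ∀ u v, u ≠ v → f u = v → G.Adj u v := by
      intro u v hne h
      by_cases hu : u = r
      · rw [hu, hfr] at h
        exact absurd (hu.trans h) hne
      · rw [← h, hf u hu]
        exact (hp u hu).1
    intro u v huv
    obtain ⟨hne, h | h⟩ := parentGraph_adj.1 huv
    · exact key u v hne h
    · exact (key v u hne.symm h).symm
  exact le_antisymm hle
    ((SimpleGraph.isTree_iff_minimal_connected.1 hG).2 hforest.isTree.connected hle)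

instance : Finite (LabeledRootedTree X) := by
  refine Finite.of_injective (fun T : LabeledRootedTree X => (T.graph, T.root)) ?_
  rintro ⟨G, hG, r⟩ ⟨G', hG', r'⟩ h
  cases h
  rfl

/-- **Cayley's formula**, for rooted trees. -/
theorem card_labeledRootedTree [Nonempty X] :
    Nat.card (LabeledRootedTree X) = Fintype.card X ^ (Fintype.card X - 1) := by
  let φ : (Σ r : X, {f : X → X // f ∈ rootedForests {r}}) → LabeledRootedTree X := fun p =>
    ⟨parentGraph p.2.1, (mem_rootedForests.1 p.2.2).isTree, p.1⟩
  have hφ : Function.Bijective φ := by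
    constructor
    · rintro ⟨r, f, hf⟩ ⟨r', g, hg⟩ h
      obtain ⟨h1, h2⟩ := LabeledRootedTree.mk.injEq .. ▸ h
      change r = r' at h2
      subst h2
      obtain rfl := (mem_rootedForests.1 hf).eq_of_parentGraph_eq (mem_rootedForests.1 hg) h1
      rfl
    · rintro ⟨G, hG, r⟩
      obtain ⟨f, hf, rfl⟩ := exists_parentGraph_eq hG r
      exact ⟨⟨r, f, mem_rootedForests.2 hf⟩, rfl⟩
  rw [← Nat.card_congr (Equiv.ofBijective φ hφ), Nat.card_sigma]
  have hpos : 0 < Fintype.card X := Fintype.card_pos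
  refine Nat.eq_of_mul_eq_mul_left hpos ?_
  rw [Finset.mul_sum]
  have h : ∀ r : X, Fintype.card X * Nat.card {f : X → X // f ∈ rootedForests {r}} =
      Fintype.card X ^ (Fintype.card X - 1) := by
    intro r
    have := card_mul_card_rootedForests ({r} : Finset X)
    rw [Finset.card_singleton, one_mul] at this
    rw [← this, Nat.card_eq_fintype_card, Fintype.card_coe]
  simp only [h]
  rw [Finset.sum_const, Finset.card_univ, smul_eq_mul]

end Cayley

/-! ### Normal multilinear monomials and rooted trees -/

section Multilinear

variable {X : Type*} [Fintype X]

theorem Monomial.isMultilinear_iff [DecidableEq X] {m : Monomial X} :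
    m.IsMultilinear ↔ m.letters = Finset.univ.val := by
  refine ⟨fun h => Multiset.ext.2 fun x => ?_, fun h x => ?_⟩
  · rw [h x, Multiset.count_eq_one_of_mem Finset.univ.nodup (Finset.mem_univ x)]
  · rw [h, Multiset.count_eq_one_of_mem Finset.univ.nodup (Finset.mem_univ x)]

variable [LinearOrder X]

theorem LabeledRootedTree.normal_monomial (T : LabeledRootedTree X) : T.monomial.Normal :=
  (componentMonomial_spec T.graph T.root T.isTree.isAcyclic).1

theorem LabeledRootedTree.root_monomial (T : LabeledRootedTree X) : T.monomial.root = T.root :=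
  (componentMonomial_spec T.graph T.root T.isTree.isAcyclic).2.1

theorem LabeledRootedTree.agrees_monomial (T : LabeledRootedTree X) :
    T.monomial.Agrees T.graph :=
  (componentMonomial_spec T.graph T.root T.isTree.isAcyclic).2.2.2.1

theorem LabeledRootedTree.letters_monomial (T : LabeledRootedTree X) :
    T.monomial.letters = Finset.univ.val := by
  have hnd := (componentMonomial_spec T.graph T.root T.isTree.isAcyclic).2.2.1
  refine (Multiset.Nodup.ext hnd Finset.univ.nodup).2 fun x =>
    iff_of_true ?_ (Finset.mem_univ x)
  have hroot : T.root ∈ T.monomial.letters := T.root_monomial ▸ T.monomial.root_mem_letters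
  obtain ⟨p⟩ := T.isTree.connected.preconnected T.root x
  have key : ∀ u v, T.graph.Walk u v → u ∈ T.monomial.letters → v ∈ T.monomial.letters := by
    intro u v p
    induction p with
    | nil => exact id
    | cons h _ ih => exact fun hu => ih ((T.agrees_monomial _ hu _).1 h).mem.2
  exact key _ _ p hroot

theorem LabeledRootedTree.monomial_injective :
    Function.Injective (LabeledRootedTree.monomial (X := X)) := by
  intro T T' h
  have hmem : ∀ (T : LabeledRootedTree X) u, u ∈ T.monomial.letters := fun T u => by
    rw [T.letters_monomial]
    exact Finset.mem_univ u
  have hgraph : T.graph = T'.graph := by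
    ext u v
    rw [T.agrees_monomial u (hmem T u) v, h, ← T'.agrees_monomial u (hmem T' u) v]
  have hroot : T.root = T'.root := by rw [← T.root_monomial, h, T'.root_monomial]
  cases T
  cases T'
  cases hgraph
  cases hroot
  rfl

theorem Monomial.Normal.isTree_graph {m : Monomial X} (hn : m.Normal)
    (hm : m.letters = Finset.univ.val) : m.graph.IsTree := by
  classical
  have hnd : m.letters.Nodup := hm ▸ Finset.univ.nodup
  have hreach : ∀ x, m.graph.Reachable m.root x := by
    intro x
    have hx : x ∈ descendants m.edges m.root :=
      hn.subset_descendants (by rw [hm]; exact Finset.mem_univ x)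
    refine descendants_subset_of_closed (A := {x | m.graph.Reachable m.root x})
      (SimpleGraph.Reachable.refl _) (fun u v huv hu => ?_) hx
    exact SimpleGraph.Reachable.trans hu ((graph_adj hnd).2 (.inl huv)).reachable
  have : Nonempty X := ⟨m.root⟩
  let parent : X → X := fun v => if h : ∃ u, m.edges (u, v) ≠ 0 then h.choose else v
  have hparent : ∀ u v, m.edges (u, v) ≠ 0 → v ≠ m.root ∧ parent v = u := by
    intro u v huv
    have h : ∃ u, m.edges (u, v) ≠ 0 := ⟨u, huv⟩
    refine ⟨fun hv => huv (hv ▸ m.edges_root hnd u), ?_⟩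
    rw [show parent v = h.choose from dif_pos h]
    exact parent_unique hnd h.choose_spec huv
  refine isTree_of_connected_of_forall_adj
    ⟨fun x y => (hreach x).symm.trans (hreach y)⟩ m.root parent fun u v huv => ?_
  exact ((graph_adj hnd).1 huv).symm.imp (hparent v u) (hparent u v)

theorem Monomial.Normal.exists_monomial_eq {m : Monomial X} (hn : m.Normal)
    (hm : m.letters = Finset.univ.val) : ∃ T : LabeledRootedTree X, T.monomial = m := by
  have hnd : m.letters.Nodup := hm ▸ Finset.univ.nodup
  exact ⟨⟨m.graph, hn.isTree_graph hm, m.root⟩,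
    Agrees.componentMonomial_eq hn hnd fun _ _ _ => graph_adj hnd⟩

variable (R : Type*) [CommRing R]

theorem span_eval_monomial :
    Submodule.span R (Set.range fun T : LabeledRootedTree X => T.monomial.eval R) =
      multilinearPart R X := by
  refine le_antisymm (Submodule.span_mono ?_) (Submodule.span_le.2 ?_)
  · rintro _ ⟨T, rfl⟩
    exact ⟨T.monomial, Monomial.isMultilinear_iff.2 T.letters_monomial, rfl⟩
  · rintro _ ⟨m, hm, rfl⟩
    rw [Monomial.isMultilinear_iff] at hm
    have hspan := eval_mem_normalSpan_of_nodup (R := R) m (hm ▸ Finset.univ.nodup)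
    refine Submodule.span_mono ?_ hspan
    rintro _ ⟨m', hn', hm', rfl⟩
    obtain ⟨T, rfl⟩ := hn'.exists_monomial_eq (hm'.trans hm)
    exact ⟨T, rfl⟩

variable (X)

/-- The basis of the multilinear part formed by the monomials of the rooted trees. -/
noncomputable def treeBasis : Module.Basis (LabeledRootedTree X) R (multilinearPart R X) :=
  (Module.Basis.span (linearIndependent_eval R LabeledRootedTree.monomial
    LabeledRootedTree.monomial_injective Finset.univ.val Finset.univ.nodup
    LabeledRootedTree.normal_monomial LabeledRootedTree.letters_monomial)).map
    (LinearEquiv.ofEq _ _ (span_eval_monomial R))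

theorem coe_treeBasis (T : LabeledRootedTree X) :
    (treeBasis X R T : FreeLie₂ R X) = T.monomial.eval R := by
  rw [treeBasis, Module.Basis.map_apply, LinearEquiv.coe_ofEq_apply, Module.Basis.span_apply]

end Multilinear

end CompatibleLie

theorem theorem1 (R : Type*) [CommRing R] (X : Type*) [LinearOrder X] [Fintype X]
    (n : ℕ) (hn : 1 ≤ n) (hX : Fintype.card X = n) :
    -- `Lie₂(n)` is free of rank `n ^ (n - 1)`
    Nonempty (Module.Basis (Fin (n ^ (n - 1))) R (CompatibleLie.multilinearPart R X)) ∧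
    -- distinct rooted trees have distinct monomials, and there are `n ^ (n - 1)` of them
    Function.Injective (CompatibleLie.LabeledRootedTree.monomial (X := X)) ∧
    (Set.range (CompatibleLie.LabeledRootedTree.monomial (X := X))).ncard = n ^ (n - 1) ∧
    -- these monomials form a basis of `Lie₂(n)`
    ∃ B : Module.Basis (CompatibleLie.LabeledRootedTree X) R
        (CompatibleLie.multilinearPart R X),
      ∀ T : CompatibleLie.LabeledRootedTree X,
        (B T : CompatibleLie.FreeLie₂ R X) = T.monomial.eval R := by
  have : Nonempty X := Fintype.card_pos_iff.1 (by omega)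
  have hcard : Nat.card (CompatibleLie.LabeledRootedTree X) = n ^ (n - 1) := by
    rw [CompatibleLie.card_labeledRootedTree, hX]
  have hinj := CompatibleLie.LabeledRootedTree.monomial_injective (X := X)
  refine ⟨⟨(CompatibleLie.treeBasis X R).reindex (Finite.equivFinOfCardEq hcard)⟩, hinj, ?_,
    CompatibleLie.treeBasis X R, CompatibleLie.coe_treeBasis X R⟩
  rw [← hcard, ← Nat.card_coe_set_eq, Nat.card_range_of_injective hinj]
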